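/- Fix an alphabet $\Sigma$. **Ipomsets.** An *ipomset* is a tuple $(P,<,\dashrightarrow,S,T,\lambda)$ of a finite set $P$ of events, two strict partial orders on $P$ (precedence $<$ and event order $\dashrightarrow$) such that any two different events are related by $<$ or $\dashrightarrow$ in some direction, a labeling $\lambda:P\to\Sigma$, and subsets $S,T\subseteq P$ (source and target interfaces) consisting of $<$-minimal, resp. $<$-maximal, events; moreover $<$ is an interval order, i.e. there are $\ell,r:P\to\mathbb R$ with $\ell\le r$ and $x<y\iff r(x)<\ell(y)$. An *isomorphism* of ipomsets is a bijection $f$ which preserves and reflects $S$, $T$ and $<$, preserves $\lambda$, and satisfies $x\dashrightarrow y\iff f(x)\dashrightarrow f(y)$ whenever $x,y$ are $<$-incomparable. Isomorphic ipomsets are identified throughout. The gluing $P*Q$ is defined if $T_P=S_Q$ as labeled sets totally ordered by $\dashrightarrow$ (up to isomorphism); then, $P$ and $Q$ having no other events in common, it has events $P\cup Q$, interfaces $S_P$ and $T_Q$, labels those of $P$ and $Q$, $x<y$ iff $x<_Py$ or $x<_Qy$ or ($x\in P\setminus T_P$ and $y\in Q\setminus S_Q$), and $\dashrightarrow$ the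 transitive closure of $\dashrightarrow_P\cup\dashrightarrow_Q$. A *starter* is an ipomset $U$ with $<$ empty and $T_U=U$, a *terminator* one with $<$ empty and $S_U=U$. $\mathrm{St},\mathrm{Te}$ are the sets of starters and terminators, $\mathrm{Id}=\mathrm{St}\cap\mathrm{Te}$ is the set of identities, $\mathrm{St}_+=\mathrm{St}\setminus\mathrm{Id}$ and $\mathrm{Te}_+=\mathrm{Te}\setminus\mathrm{Id}$. **Interval delay words.** A word over $\mathrm{St}\cup\mathrm{Te}\cup\mathbb R_{\ge0}$ is *coherent* if any two of its letters in $\mathrm{St}\cup\mathrm{Te}$ which are separated only by (possibly no) letters in $\mathbb R_{\ge 0}$ can be glued, in the order in which they occur. Let $\sim$ be the congruence on coherent words generated by $dd'\sim d+d'$, $0\sim\epsilon$, $I\sim\epsilon$ ($I\in\mathrm{Id}$), $S_1S_2\sim S_1*S_2$ ($S_i\in\mathrm{St}$) and $T_1T_2\sim T_1*T_2$ ($T_i\in\mathrm{Te}$). An *interval delay word* (idword) is a coherent word $I.w.J$ with $I,J\in\mathrm{Id}$, where the inner part $w$ is taken up to $\sim$. A representative $I_0\,d_0\,P_1\,d_1\dots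 P_n\,d_n\,I_{n+1}$ ($n\ge0$, $I_0,I_{n+1}\in\mathrm{Id}$, $P_i\in\mathrm{St}\cup\mathrm{Te}$, $d_i\in\mathbb R_{\ge 0}$) of an idword is *sparse* if no $P_i$ with $1\le i\le n$ is an identity and, for all $1\le i\le n-1$ with $d_i=0$, $(P_i,P_{i+1})\in\mathrm{St}_+\times\mathrm{Te}_+\cup\mathrm{Te}_+\times\mathrm{St}_+$. **Timed ipomsets.** A *timed ipomset* (tipomset) is an ipomset $P$ with functions $\sigma^-,\sigma^+:P\to\mathbb R_{\ge0}$ and a duration $d\in\mathbb R_{\ge0}$ such that $\sigma^-\le\sigma^+\le d$, $\sigma^-=0$ on $S$, $\sigma^+=d$ on $T$, and $\sigma^+(x)<\sigma^-(y)\Rightarrow x<y\Rightarrow\sigma^+(x)\le\sigma^-(y)$ for all $x,y\in P$. Isomorphisms of tipomsets are isomorphisms of ipomsets which preserve $\sigma^\pm$ and $d$; isomorphic tipomsets are identified. **The map.** For a sparse representative as above, let $P=I_0*P_1*\dots*P_n*I_{n+1}$ (which is $P_1*\dots*P_n$ if $n\ge1$ and $I_0$ if $n=0$), write $P_0=I_0$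 and $P_{n+1}=I_{n+1}$, and for $x\in P$ let $\mathrm{first}(x)$ and $\mathrm{last}(x)$ be the least and the greatest $i\in\{0,\dots,n+1\}$ such that $x\in P_i$. Put $d_P=\sum_{i=0}^n d_i$, $\sigma^-(x)=\sum_{0\le i<\mathrm{first}(x)}d_i$ and $\sigma^+(x)=\sum_{0\le i<\mathrm{last}(x)}d_i$ (so that $\sigma^-(x)=0$ if $\mathrm{first}(x)=0$, and $\sigma^+(x)=d_P$ if $\mathrm{last}(x)=n+1$). **Lemma.** Every idword has a unique sparse representative. Hence there is a well-defined map $\mathrm{tGlue}$ from idwords to tipomsets which sends the idword with sparse representative $I_0d_0P_1d_1\dots P_nd_nI_{n+1}$ to the tipomset $(P,\sigma,d_P)$ above, and $\mathrm{tGlue}$ is a bijection between idwords and tipomsets. -/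

import Mathlib

open scoped NNReal

universe u

namespace TimedConc

/-! ### Ipomsets -/

/-- An (interval) pomset with interfaces over the alphabet `α`: a finite set `Ev` of events with
precedence order `lt`, event order `ev`, source and target interfaces `S`, `T` and labels `lab`. -/
structure Ipomset (α : Type u) where
  Ev : Type
  finite : Finite Ev
  lt : Ev → Ev → Prop
  ev : Ev → Ev → Prop
  S : Set Ev
  T : Set Ev
  lab : Ev → α
  lt_irrefl : ∀ x, ¬ lt x x
  lt_trans : ∀ x y z, lt x y → lt y z → lt x z
  ev_irrefl : ∀ x, ¬ ev x x
  ev_trans : ∀ x y z, ev x y → ev y z → ev x z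
  ordered : ∀ x y, x ≠ y → lt x y ∨ lt y x ∨ ev x y ∨ ev y x
  S_minimal : ∀ x ∈ S, ∀ y, ¬ lt y x
  T_maximal : ∀ x ∈ T, ∀ y, ¬ lt x y
  interval : ∃ lo hi : Ev → ℝ, (∀ x, lo x ≤ hi x) ∧ ∀ x y, lt x y ↔ hi x < lo y

/-- Isomorphisms of ipomsets; only the essential event order (the one between
`lt`-incomparable events) has to be preserved. -/
structure Ipomset.Iso {α : Type u} (P Q : Ipomset α) where
  map : P.Ev ≃ Q.Ev
  map_S : ∀ x, map x ∈ Q.S ↔ x ∈ P.S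
  map_T : ∀ x, map x ∈ Q.T ↔ x ∈ P.T
  map_lab : ∀ x, Q.lab (map x) = P.lab x
  map_lt : ∀ x y, Q.lt (map x) (map y) ↔ P.lt x y
  map_ev : ∀ x y, ¬ P.lt x y → ¬ P.lt y x → (P.ev x y ↔ Q.ev (map x) (map y))

def Ipomset.Iso.refl {α : Type u} (P : Ipomset α) : P.Iso P where
  map := Equiv.refl _
  map_S _ := Iff.rfl
  map_T _ := Iff.rfl
  map_lab _ := rfl
  map_lt _ _ := Iff.rfl
  map_ev _ _ _ _ := Iff.rfl

def Ipomset.Iso.symm {α : Type u} {P Q : Ipomset α} (f : P.Iso Q) : Q.Iso P where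
  map := f.map.symm
  map_S x := by simpa using (f.map_S (f.map.symm x)).symm
  map_T x := by simpa using (f.map_T (f.map.symm x)).symm
  map_lab x := by simpa using (f.map_lab (f.map.symm x)).symm
  map_lt x y := by simpa using (f.map_lt (f.map.symm x) (f.map.symm y)).symm
  map_ev x y h h' := by
    have h1 := f.map_lt (f.map.symm x) (f.map.symm y)
    have h2 := f.map_lt (f.map.symm y) (f.map.symm x)
    have h3 := f.map_ev (f.map.symm x) (f.map.symm y)
    simp only [Equiv.apply_symm_apply] at h1 h2 h3
    exact (h3 (fun k => h (h1.2 k)) (fun k => h' (h2.2 k))).symm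

def Ipomset.Iso.trans {α : Type u} {P Q R : Ipomset α} (f : P.Iso Q) (g : Q.Iso R) :
    P.Iso R where
  map := f.map.trans g.map
  map_S x := (g.map_S _).trans (f.map_S x)
  map_T x := (g.map_T _).trans (f.map_T x)
  map_lab x := (g.map_lab _).trans (f.map_lab x)
  map_lt x y := (g.map_lt _ _).trans (f.map_lt x y)
  map_ev x y h h' := (f.map_ev x y h h').trans
    (g.map_ev _ _ (fun k => h ((f.map_lt x y).1 k)) (fun k => h' ((f.map_lt y x).1 k)))

/-! ### Gluing -/

/-- An identification of the target interface of `P` with the source interface of `Q` as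
conclists (there is at most one, as the event order is total on interfaces). -/
structure Ipomset.Iface {α : Type u} (P Q : Ipomset α) where
  e : P.T ≃ Q.S
  lab_eq : ∀ x : P.T, P.lab x = Q.lab (e x)
  ev_iff : ∀ x y : P.T, P.ev x y ↔ Q.ev (e x) (e y)

/-- The gluing `P * Q` is defined. -/
def Ipomset.Composable {α : Type u} (P Q : Ipomset α) : Prop := Nonempty (P.Iface Q)

section Gluing

variable {α : Type u} {P Q : Ipomset α}

/-- The events of `P * Q`: the union of the events of `P` and `Q`, with `P.T` and `Q.S`
identified. -/
abbrev Ipomset.Iface.GEv (_m : P.Iface Q) : Type := P.Ev ⊕ {q : Q.Ev // q ∉ Q.S}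

/-- The inclusion of the events of `P` into those of `P * Q`. -/
def Ipomset.Iface.inP (m : P.Iface Q) (p : P.Ev) : m.GEv := Sum.inl p

open Classical in
/-- The inclusion of the events of `Q` into those of `P * Q`. -/
noncomputable def Ipomset.Iface.inQ (m : P.Iface Q) (q : Q.Ev) : m.GEv :=
  if h : q ∈ Q.S then Sum.inl (m.e.symm ⟨q, h⟩ : P.Ev) else Sum.inr ⟨q, h⟩

/-- The event order of `P`, on the events of `P * Q`. -/
def Ipomset.Iface.evP (m : P.Iface Q) (x y : m.GEv) : Prop :=
  ∃ p p', P.ev p p' ∧ x = m.inP p ∧ y = m.inP p'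

/-- The event order of `Q`, on the events of `P * Q`. -/
def Ipomset.Iface.evQ (m : P.Iface Q) (x y : m.GEv) : Prop :=
  ∃ q q', Q.ev q q' ∧ x = m.inQ q ∧ y = m.inQ q'

/-- The event order of `P * Q`. -/
def Ipomset.Iface.gev (m : P.Iface Q) : m.GEv → m.GEv → Prop :=
  Relation.TransGen (fun x y => m.evP x y ∨ m.evQ x y)

/-- The precedence order of `P * Q`. -/
def Ipomset.Iface.glt (m : P.Iface Q) (x y : m.GEv) : Prop :=
  (∃ p p', P.lt p p' ∧ x = m.inP p ∧ y = m.inP p') ∨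
  (∃ q q', Q.lt q q' ∧ x = m.inQ q ∧ y = m.inQ q') ∨
  (∃ p q, p ∉ P.T ∧ q ∉ Q.S ∧ x = m.inP p ∧ y = m.inQ q)

/-- The labels of `P * Q`. -/
def Ipomset.Iface.glab (m : P.Iface Q) : m.GEv → α :=
  Sum.elim P.lab (fun q => Q.lab q)

theorem Ipomset.Iface.inP_injective (m : P.Iface Q) : Function.Injective m.inP :=
  Sum.inl_injective

theorem Ipomset.Iface.inQ_of_mem (m : P.Iface Q) {q : Q.Ev} (h : q ∈ Q.S) :
    m.inQ q = m.inP (m.e.symm ⟨q, h⟩) := by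
  simp [inQ, inP, h]

theorem Ipomset.Iface.inQ_of_not_mem (m : P.Iface Q) {q : Q.Ev} (h : q ∉ Q.S) :
    m.inQ q = Sum.inr ⟨q, h⟩ := by
  simp [inQ, h]

theorem Ipomset.Iface.inQ_e (m : P.Iface Q) (t : P.T) : m.inQ (m.e t) = m.inP t := by
  rw [m.inQ_of_mem (m.e t).2]; simp

theorem Ipomset.Iface.inQ_eq_inP (m : P.Iface Q) {q : Q.Ev} {p : P.Ev} (h : m.inQ q = m.inP p) :
    ∃ hp : p ∈ P.T, q = m.e ⟨p, hp⟩ := by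
  by_cases hq : q ∈ Q.S
  · rw [m.inQ_of_mem hq] at h
    have h1 := m.inP_injective h
    subst h1
    exact ⟨(m.e.symm ⟨q, hq⟩).2, by simp⟩
  · rw [m.inQ_of_not_mem hq] at h
    simp [inP] at h

theorem Ipomset.Iface.inQ_injective (m : P.Iface Q) : Function.Injective m.inQ := by
  intro q q' h
  by_cases hq : q' ∈ Q.S
  · rw [m.inQ_of_mem hq] at h
    obtain ⟨_, h1⟩ := m.inQ_eq_inP h
    simpa using h1
  · by_cases hq' : q ∈ Q.S
    · rw [m.inQ_of_mem hq'] at h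
      obtain ⟨_, h1⟩ := m.inQ_eq_inP h.symm
      simpa using h1.symm
    · rw [m.inQ_of_not_mem hq, m.inQ_of_not_mem hq'] at h
      simpa using h

theorem Ipomset.Iface.cases (m : P.Iface Q) (x : m.GEv) :
    (∃ p, x = m.inP p) ∨ ∃ q, q ∉ Q.S ∧ x = m.inQ q := by
  rcases x with p | ⟨q, hq⟩
  · exact Or.inl ⟨p, rfl⟩
  · exact Or.inr ⟨q, hq, (m.inQ_of_not_mem hq).symm⟩

theorem Ipomset.Iface.evP_inP (m : P.Iface Q) (p p' : P.Ev) :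
    m.evP (m.inP p) (m.inP p') ↔ P.ev p p' := by
  constructor
  · rintro ⟨a, b, h, h1, h2⟩
    rwa [m.inP_injective h1, m.inP_injective h2]
  · exact fun h => ⟨p, p', h, rfl, rfl⟩

theorem Ipomset.Iface.evQ_inQ (m : P.Iface Q) (q q' : Q.Ev) :
    m.evQ (m.inQ q) (m.inQ q') ↔ Q.ev q q' := by
  constructor
  · rintro ⟨a, b, h, h1, h2⟩
    rwa [m.inQ_injective h1, m.inQ_injective h2]
  · exact fun h => ⟨q, q', h, rfl, rfl⟩

/-- Both event orders agree on the common interface. -/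
theorem Ipomset.Iface.evP_iff_evQ (m : P.Iface Q) {x y : m.GEv}
    (hx : x ∈ Set.range m.inP ∩ Set.range m.inQ) (hy : y ∈ Set.range m.inP ∩ Set.range m.inQ) :
    m.evP x y ↔ m.evQ x y := by
  obtain ⟨⟨p, rfl⟩, ⟨q, hq⟩⟩ := hx
  obtain ⟨⟨p', rfl⟩, ⟨q', hq'⟩⟩ := hy
  obtain ⟨hp, rfl⟩ := m.inQ_eq_inP hq
  obtain ⟨hp', rfl⟩ := m.inQ_eq_inP hq'
  rw [m.evP_inP, ← hq, ← hq', m.evQ_inQ]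
  exact m.ev_iff ⟨p, hp⟩ ⟨p', hp'⟩

theorem Ipomset.Iface.evP_range (m : P.Iface Q) {x y : m.GEv} (h : m.evP x y) :
    x ∈ Set.range m.inP ∧ y ∈ Set.range m.inP := by
  obtain ⟨a, b, _, rfl, rfl⟩ := h
  exact ⟨⟨a, rfl⟩, ⟨b, rfl⟩⟩

theorem Ipomset.Iface.evQ_range (m : P.Iface Q) {x y : m.GEv} (h : m.evQ x y) :
    x ∈ Set.range m.inQ ∧ y ∈ Set.range m.inQ := by
  obtain ⟨a, b, _, rfl, rfl⟩ := h
  exact ⟨⟨a, rfl⟩, ⟨b, rfl⟩⟩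

theorem Ipomset.Iface.evP_trans (m : P.Iface Q) {x y z : m.GEv} (h : m.evP x y)
    (h' : m.evP y z) : m.evP x z := by
  obtain ⟨a, b, hab, rfl, rfl⟩ := h
  obtain ⟨c, d, hcd, hc, rfl⟩ := h'
  rw [← m.inP_injective hc] at hcd
  exact ⟨a, d, P.ev_trans _ _ _ hab hcd, rfl, rfl⟩

theorem Ipomset.Iface.evQ_trans (m : P.Iface Q) {x y z : m.GEv} (h : m.evQ x y)
    (h' : m.evQ y z) : m.evQ x z := by
  obtain ⟨a, b, hab, rfl, rfl⟩ := h
  obtain ⟨c, d, hcd, hc, rfl⟩ := h'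
  rw [← m.inQ_injective hc] at hcd
  exact ⟨a, d, Q.ev_trans _ _ _ hab hcd, rfl, rfl⟩

/-- A transitive closure step changes side at most once. -/
theorem Ipomset.Iface.gev_cases (m : P.Iface Q) {x y : m.GEv} (h : m.gev x y) :
    m.evP x y ∨ m.evQ x y ∨ (∃ t, m.evP x t ∧ m.evQ t y) ∨ (∃ t, m.evQ x t ∧ m.evP t y) := by
  induction h with
  | single h => rcases h with h | h <;> simp [h]
  | @tail y z _ h ih =>
    rcases h with h | h
    · rcases ih with k | k | ⟨t, k, k'⟩ | ⟨t, k, k'⟩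
      · exact Or.inl (m.evP_trans k h)
      · exact Or.inr (Or.inr (Or.inr ⟨y, k, h⟩))
      · have := (m.evP_iff_evQ ⟨(m.evP_range k).2, (m.evQ_range k').1⟩
          ⟨(m.evP_range h).1, (m.evQ_range k').2⟩).2 k'
        exact Or.inl (m.evP_trans k (m.evP_trans this h))
      · exact Or.inr (Or.inr (Or.inr ⟨t, k, m.evP_trans k' h⟩))
    · rcases ih with k | k | ⟨t, k, k'⟩ | ⟨t, k, k'⟩
      · exact Or.inr (Or.inr (Or.inl ⟨y, k, h⟩))
      · exact Or.inr (Or.inl (m.evQ_trans k h))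
      · exact Or.inr (Or.inr (Or.inl ⟨t, k, m.evQ_trans k' h⟩))
      · have := (m.evP_iff_evQ ⟨(m.evP_range k').1, (m.evQ_range k).2⟩
          ⟨(m.evP_range k').2, (m.evQ_range h).1⟩).1 k'
        exact Or.inr (Or.inl (m.evQ_trans k (m.evQ_trans this h)))

theorem Ipomset.Iface.gev_inP (m : P.Iface Q) (p p' : P.Ev) :
    m.gev (m.inP p) (m.inP p') ↔ P.ev p p' := by
  rw [← m.evP_inP]
  refine ⟨fun h => ?_, fun h => Relation.TransGen.single (Or.inl h)⟩
  have hp : m.inP p ∈ Set.range m.inP := ⟨p, rfl⟩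
  have hp' : m.inP p' ∈ Set.range m.inP := ⟨p', rfl⟩
  rcases m.gev_cases h with k | k | ⟨t, k, k'⟩ | ⟨t, k, k'⟩
  · exact k
  · exact (m.evP_iff_evQ ⟨hp, (m.evQ_range k).1⟩ ⟨hp', (m.evQ_range k).2⟩).2 k
  · exact m.evP_trans k ((m.evP_iff_evQ ⟨(m.evP_range k).2, (m.evQ_range k').1⟩
      ⟨hp', (m.evQ_range k').2⟩).2 k')
  · exact m.evP_trans ((m.evP_iff_evQ ⟨hp, (m.evQ_range k).1⟩
      ⟨(m.evP_range k').1, (m.evQ_range k).2⟩).2 k) k'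

theorem Ipomset.Iface.gev_inQ (m : P.Iface Q) (q q' : Q.Ev) :
    m.gev (m.inQ q) (m.inQ q') ↔ Q.ev q q' := by
  rw [← m.evQ_inQ]
  refine ⟨fun h => ?_, fun h => Relation.TransGen.single (Or.inr h)⟩
  have hq : m.inQ q ∈ Set.range m.inQ := ⟨q, rfl⟩
  have hq' : m.inQ q' ∈ Set.range m.inQ := ⟨q', rfl⟩
  rcases m.gev_cases h with k | k | ⟨t, k, k'⟩ | ⟨t, k, k'⟩
  · exact (m.evP_iff_evQ ⟨(m.evP_range k).1, hq⟩ ⟨(m.evP_range k).2, hq'⟩).1 k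
  · exact k
  · exact m.evQ_trans ((m.evP_iff_evQ ⟨(m.evP_range k).1, hq⟩
      ⟨(m.evP_range k).2, (m.evQ_range k').1⟩).1 k) k'
  · exact m.evQ_trans k ((m.evP_iff_evQ ⟨(m.evP_range k').1, (m.evQ_range k).2⟩
      ⟨(m.evP_range k').2, hq'⟩).1 k')

theorem Ipomset.Iface.glt_inP (m : P.Iface Q) (p p' : P.Ev) :
    m.glt (m.inP p) (m.inP p') ↔ P.lt p p' := by
  refine ⟨?_, fun h => Or.inl ⟨p, p', h, rfl, rfl⟩⟩
  rintro (⟨a, b, h, h1, h2⟩ | ⟨a, b, h, h1, h2⟩ | ⟨a, b, _, hb, _, h2⟩)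
  · rwa [m.inP_injective h1, m.inP_injective h2]
  · obtain ⟨_, rfl⟩ := m.inQ_eq_inP h2.symm
    exact (Q.S_minimal _ (m.e _).2 _ h).elim
  · obtain ⟨_, rfl⟩ := m.inQ_eq_inP h2.symm
    exact (hb (m.e _).2).elim

theorem Ipomset.Iface.glt_inQ (m : P.Iface Q) (q q' : Q.Ev) :
    m.glt (m.inQ q) (m.inQ q') ↔ Q.lt q q' := by
  refine ⟨?_, fun h => Or.inr (Or.inl ⟨q, q', h, rfl, rfl⟩)⟩
  rintro (⟨a, b, h, h1, h2⟩ | ⟨a, b, h, h1, h2⟩ | ⟨a, b, ha, _, h1, _⟩)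
  · obtain ⟨ha, _⟩ := m.inQ_eq_inP h1
    exact (P.T_maximal a ha _ h).elim
  · rwa [m.inQ_injective h1, m.inQ_injective h2]
  · exact (ha (m.inQ_eq_inP h1).1).elim

theorem Ipomset.Iface.glt_inP_inQ (m : P.Iface Q) {p : P.Ev} {q : Q.Ev} (hp : p ∉ P.T)
    (hq : q ∉ Q.S) : m.glt (m.inP p) (m.inQ q) :=
  Or.inr (Or.inr ⟨p, q, hp, hq, rfl, rfl⟩)

theorem Ipomset.Iface.not_glt_inQ_inP (m : P.Iface Q) {p : P.Ev} {q : Q.Ev} (hq : q ∉ Q.S) :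
    ¬ m.glt (m.inQ q) (m.inP p) := by
  rintro (⟨a, b, h, h1, h2⟩ | ⟨a, b, h, h1, h2⟩ | ⟨a, b, _, _, h1, _⟩)
  · obtain ⟨_, rfl⟩ := m.inQ_eq_inP h1
    exact hq (m.e _).2
  · obtain ⟨_, rfl⟩ := m.inQ_eq_inP h2.symm
    exact Q.S_minimal _ (m.e _).2 _ h
  · obtain ⟨_, rfl⟩ := m.inQ_eq_inP h1
    exact hq (m.e _).2

theorem Ipomset.Iface.glt_interval (m : P.Iface Q) :
    ∃ lo hi : m.GEv → ℝ, (∀ x, lo x ≤ hi x) ∧ ∀ x y, m.glt x y ↔ hi x < lo y := by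
  classical
  obtain ⟨lP, hP, h1, h2⟩ := P.interval
  obtain ⟨lQ, hQ, k1, k2⟩ := Q.interval
  have := P.finite
  have := Q.finite
  obtain ⟨M, hM⟩ := (Set.finite_range hP).bddAbove
  obtain ⟨N, hN⟩ := (Set.finite_range lQ).bddBelow
  have hM' : ∀ p, hP p ≤ M := fun p => hM ⟨p, rfl⟩
  have hN' : ∀ q, N ≤ lQ q := fun q => hN ⟨q, rfl⟩
  have hN'' : ∀ q, N ≤ hQ q := fun q => (hN' q).trans (k1 q)
  have hM'' : ∀ p, lP p ≤ M := fun p => (h1 p).trans (hM' p)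
  refine ⟨Sum.elim lP (fun q => lQ q - N + M + 1),
    Sum.elim (fun p => if h : p ∈ P.T then hQ (m.e ⟨p, h⟩) - N + M + 1 else hP p)
      (fun q => hQ q - N + M + 1), ?_, ?_⟩
  · rintro (p | ⟨q, hq⟩)
    · by_cases h : p ∈ P.T
      · have := hN'' (m.e ⟨p, h⟩)
        have := hM'' p
        simp only [Sum.elim_inl, h, dif_pos]
        linarith
      · simpa [h] using h1 p
    · simpa using k1 q
  · rintro (p | ⟨q, hq⟩) (p' | ⟨q', hq'⟩)
    · rw [show (Sum.inl p : m.GEv) = m.inP p from rfl, show (Sum.inl p' : m.GEv) = m.inP p' from rfl,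
        m.glt_inP]
      by_cases h : p ∈ P.T
      · have h3 := P.T_maximal p h p'
        have := hN'' (m.e ⟨p, h⟩)
        have := hM'' p'
        simp only [Ipomset.Iface.inP, Sum.elim_inl, h, dif_pos, h3, false_iff]
        linarith
      · simpa [Ipomset.Iface.inP, h] using h2 p p'
    · rw [show (Sum.inl p : m.GEv) = m.inP p from rfl, ← m.inQ_of_not_mem hq']
      by_cases h : p ∈ P.T
      · rw [← m.inQ_e ⟨p, h⟩, m.glt_inQ, m.inQ_e, m.inQ_of_not_mem hq', k2]
        simp [Ipomset.Iface.inP, h]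
      · have := m.glt_inP_inQ h hq'
        have h3 := hM' p
        have h4 := hN' q'
        simp only [this, true_iff]
        rw [m.inQ_of_not_mem hq']
        simp only [Ipomset.Iface.inP, Sum.elim_inl, Sum.elim_inr, h, dif_neg, not_false_eq_true]
        linarith
    · rw [show (Sum.inl p' : m.GEv) = m.inP p' from rfl, ← m.inQ_of_not_mem hq]
      have h3 := hN'' q
      have h4 := hM'' p'
      simp only [m.not_glt_inQ_inP hq, false_iff]
      rw [m.inQ_of_not_mem hq]
      simp only [Ipomset.Iface.inP, Sum.elim_inl, Sum.elim_inr]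
      linarith
    · rw [← m.inQ_of_not_mem hq, ← m.inQ_of_not_mem hq', m.glt_inQ, k2,
        m.inQ_of_not_mem hq, m.inQ_of_not_mem hq']
      simp

/-- The gluing composition `P * Q` along an identification of the interfaces. -/
noncomputable def Ipomset.glue (P Q : Ipomset α) (m : P.Iface Q) : Ipomset α where
  Ev := m.GEv
  finite := by
    have := P.finite
    have := Q.finite
    infer_instance
  lt := m.glt
  ev := m.gev
  S := m.inP '' P.S
  T := m.inQ '' Q.T
  lab := m.glab
  lt_irrefl x h := by
    obtain ⟨lo, hi, h1, h2⟩ := m.glt_interval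
    exact absurd ((h2 x x).1 h) (not_lt.2 (h1 x))
  lt_trans x y z h h' := by
    obtain ⟨lo, hi, h1, h2⟩ := m.glt_interval
    exact (h2 x z).2 (((h2 x y).1 h).trans_le ((h1 y).trans ((h2 y z).1 h').le))
  ev_irrefl x h := by
    rcases m.cases x with ⟨p, rfl⟩ | ⟨q, _, rfl⟩
    · exact P.ev_irrefl p ((m.gev_inP p p).1 h)
    · exact Q.ev_irrefl q ((m.gev_inQ q q).1 h)
  ev_trans _ _ _ h h' := Relation.TransGen.trans h h'
  ordered x y hxy := by
    rcases m.cases x with ⟨p, rfl⟩ | ⟨q, hq, rfl⟩ <;> rcases m.cases y with ⟨p', rfl⟩ | ⟨q', hq', rfl⟩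
    · simp only [m.glt_inP, m.gev_inP]
      exact P.ordered p p' (fun h => hxy (h ▸ rfl))
    · by_cases h : p ∈ P.T
      · rw [← m.inQ_e ⟨p, h⟩] at hxy ⊢
        simp only [m.glt_inQ, m.gev_inQ]
        exact Q.ordered _ _ (fun h => hxy (h ▸ rfl))
      · exact Or.inl (m.glt_inP_inQ h hq')
    · by_cases h : p' ∈ P.T
      · rw [← m.inQ_e ⟨p', h⟩] at hxy ⊢
        simp only [m.glt_inQ, m.gev_inQ]
        exact Q.ordered _ _ (fun h => hxy (h ▸ rfl))
      · exact Or.inr (Or.inl (m.glt_inP_inQ h hq))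
    · simp only [m.glt_inQ, m.gev_inQ]
      exact Q.ordered q q' (fun h => hxy (h ▸ rfl))
  S_minimal := by
    rintro _ ⟨p, hp, rfl⟩ y h
    rcases m.cases y with ⟨p', rfl⟩ | ⟨q, hq, rfl⟩
    · exact P.S_minimal p hp p' ((m.glt_inP _ _).1 h)
    · exact m.not_glt_inQ_inP hq h
  T_maximal := by
    rintro _ ⟨q, hq, rfl⟩ y h
    rcases m.cases y with ⟨p', rfl⟩ | ⟨q', hq', rfl⟩
    · by_cases hS : q ∈ Q.S
      · rw [m.inQ_of_mem hS, m.glt_inP] at h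
        exact P.T_maximal _ (m.e.symm ⟨q, hS⟩).2 _ h
      · exact m.not_glt_inQ_inP hS h
    · exact Q.T_maximal q hq q' ((m.glt_inQ _ _).1 h)
  interval := m.glt_interval

/-- If `O * P` is defined, then so is `O * (P * Q)`. -/
theorem Ipomset.composable_glue {O P Q : Ipomset α} (m : P.Iface Q) (h : O.Composable P) :
    O.Composable (P.glue Q m) := by
  obtain ⟨k⟩ := h
  refine ⟨⟨k.e.trans (Equiv.Set.image m.inP P.S m.inP_injective), ?_, ?_⟩⟩
  · intro x
    exact k.lab_eq x
  · intro x y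
    exact (k.ev_iff x y).trans (m.gev_inP _ _).symm

end Gluing

/-! ### Starters, terminators, identities -/

section Steps

variable {α : Type u}

def Ipomset.IsDiscrete (P : Ipomset α) : Prop := ∀ x y, ¬ P.lt x y

/-- `P ∈ St`. -/
def Ipomset.IsStarter (P : Ipomset α) : Prop := P.IsDiscrete ∧ P.T = Set.univ

/-- `P ∈ Te`. -/
def Ipomset.IsTerminator (P : Ipomset α) : Prop := P.IsDiscrete ∧ P.S = Set.univ

/-- `P ∈ Id = St ∩ Te`. -/
def Ipomset.IsId (P : Ipomset α) : Prop := P.IsStarter ∧ P.IsTerminator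

/-- `P ∈ St₊`. -/
def Ipomset.IsStarterPlus (P : Ipomset α) : Prop := P.IsStarter ∧ ¬ P.IsId

/-- `P ∈ Te₊`. -/
def Ipomset.IsTerminatorPlus (P : Ipomset α) : Prop := P.IsTerminator ∧ ¬ P.IsId

end Steps

/-- The elements of `St ∪ Te`. -/
structure Step (α : Type u) where
  pom : Ipomset α
  starter_or_terminator : pom.IsStarter ∨ pom.IsTerminator

/-- The elements of `Id`. -/
structure Ident (α : Type u) where
  pom : Ipomset α
  isId : pom.IsId

def Ident.toStep {α : Type u} (I : Ident α) : Step α := ⟨I.pom, Or.inl I.isId.1⟩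

theorem Step.isDiscrete {α : Type u} (P : Step α) : P.pom.IsDiscrete :=
  P.starter_or_terminator.elim (fun h => h.1) (fun h => h.1)

/-! ### Interval delay words -/

/-- Words over `St ∪ Te ∪ ℝ≥0`. -/
abbrev DWord (α : Type u) := List (Step α ⊕ ℝ≥0)

/-- The starters and terminators of a word, in order, as ipomsets. -/
def DWord.steps {α : Type u} (w : DWord α) : List (Ipomset α) :=
  w.filterMap (Sum.elim (fun P => some P.pom) (fun _ => none))

/-- A word is coherent if any two of its steps which are separated by delays only can be
glued. -/
def DWord.Coherent {α : Type u} (w : DWord α) : Prop := w.steps.IsChain Ipomset.Composable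

/-- The generating relations. Isomorphic ipomsets are identified, so that `S₁ * S₂` stands for
any step isomorphic to the gluing. -/
inductive Gen {α : Type u} : DWord α → DWord α → Prop
  | delay (d d' : ℝ≥0) : Gen [Sum.inr d, Sum.inr d'] [Sum.inr (d + d')]
  | zero : Gen [Sum.inr 0] []
  | ident (I : Step α) (hI : I.pom.IsId) : Gen [Sum.inl I] []
  | starters (S₁ S₂ R : Step α) (h₁ : S₁.pom.IsStarter) (h₂ : S₂.pom.IsStarter)
      (m : S₁.pom.Iface S₂.pom) (i : R.pom.Iso (S₁.pom.glue S₂.pom m)) :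
      Gen [Sum.inl S₁, Sum.inl S₂] [Sum.inl R]
  | terminators (T₁ T₂ R : Step α) (h₁ : T₁.pom.IsTerminator) (h₂ : T₂.pom.IsTerminator)
      (m : T₁.pom.Iface T₂.pom) (i : R.pom.Iso (T₁.pom.glue T₂.pom m)) :
      Gen [Sum.inl T₁, Sum.inl T₂] [Sum.inl R]
  | iso (P Q : Step α) (i : P.pom.Iso Q.pom) : Gen [Sum.inl P] [Sum.inl Q]

/-- Application of a generating relation inside a coherent word. -/
inductive Rewrite {α : Type u} : DWord α → DWord α → Prop
  | ctx (u a b v : DWord α) (h : Gen a b) (ha : DWord.Coherent (u ++ a ++ v))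
      (hb : DWord.Coherent (u ++ b ++ v)) : Rewrite (u ++ a ++ v) (u ++ b ++ v)

/-- The congruence on coherent words generated by the relations. -/
def Cong {α : Type u} : DWord α → DWord α → Prop := Relation.EqvGen Rewrite

/-- A coherent word `I.w.J` in `Id.(St ∪ Te ∪ ℝ≥0)*.Id`. -/
structure IdwRep (α : Type u) where
  I : Ident α
  w : DWord α
  J : Ident α
  coherent : DWord.Coherent (Sum.inl I.toStep :: w ++ [Sum.inl J.toStep])

/-- Two words represent the same idword if their inner parts are congruent and the identities at
the ends are the same (up to isomorphism). -/
instance IdwRep.setoid (α : Type u) : Setoid (IdwRep α) where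
  r x y := Nonempty (x.I.pom.Iso y.I.pom) ∧ Cong x.w y.w ∧ Nonempty (x.J.pom.Iso y.J.pom)
  iseqv :=
    { refl := fun _ => ⟨⟨.refl _⟩, Relation.EqvGen.refl _, ⟨.refl _⟩⟩
      symm := fun ⟨⟨i⟩, c, ⟨j⟩⟩ => ⟨⟨i.symm⟩, c.symm, ⟨j.symm⟩⟩
      trans := fun ⟨⟨i⟩, c, ⟨j⟩⟩ ⟨⟨i'⟩, c', ⟨j'⟩⟩ =>
        ⟨⟨i.trans i'⟩, c.trans _ _ _ c', ⟨j.trans j'⟩⟩ }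

/-- The set of interval delay words. -/
def IDW (α : Type u) := Quotient (IdwRep.setoid α)

/-- Interval delay words in sparse form `I₀ d₀ P₁ d₁ … Pₙ dₙ Iₙ₊₁`, where `steps` is the list of
pairs `(Pᵢ, dᵢ)` for `1 ≤ i ≤ n`. -/
structure SparseIdw (α : Type u) where
  I : Ident α
  d₀ : ℝ≥0
  steps : List (Step α × ℝ≥0)
  J : Ident α
  coherent : List.IsChain Ipomset.Composable
    (I.pom :: (steps.map (fun s => s.1.pom) ++ [J.pom]))
  not_id : ∀ s ∈ steps, ¬ s.1.pom.IsId
  alternating : steps.IsChain (fun s s' => s.2 = 0 →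
    (s.1.pom.IsStarterPlus ∧ s'.1.pom.IsTerminatorPlus) ∨
    (s.1.pom.IsTerminatorPlus ∧ s'.1.pom.IsStarterPlus))

/-- The inner part `d₀ P₁ d₁ … Pₙ dₙ`. -/
def SparseIdw.inner {α : Type u} (w : SparseIdw α) : DWord α :=
  Sum.inr w.d₀ :: w.steps.flatMap (fun s => [Sum.inl s.1, Sum.inr s.2])

theorem DWord.steps_flatMap {α : Type u} (l : List (Step α × ℝ≥0)) (J : Step α) :
    DWord.steps (l.flatMap (fun s => [Sum.inl s.1, Sum.inr s.2]) ++ [Sum.inl J]) =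
      l.map (fun s => s.1.pom) ++ [J.pom] := by
  induction l with
  | nil => simp [DWord.steps]
  | cons s l ih => simpa [DWord.steps, List.filterMap_cons] using ih

/-- The interval delay word represented by a sparse form. -/
def SparseIdw.toIDW {α : Type u} (w : SparseIdw α) : IDW α :=
  Quotient.mk _
    { I := w.I
      w := w.inner
      J := w.J
      coherent := by
        have h := w.coherent
        have := DWord.steps_flatMap w.steps w.J.toStep
        rw [show w.J.pom = w.J.toStep.pom from rfl, ← this] at h
        simpa [DWord.Coherent, SparseIdw.inner, DWord.steps, List.filterMap_cons, Ident.toStep] using h }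

/-- Equality of sparse forms, with isomorphic ipomsets identified. -/
def SparseIdw.Same {α : Type u} (w w' : SparseIdw α) : Prop :=
  Nonempty (w.I.pom.Iso w'.I.pom) ∧ w.d₀ = w'.d₀ ∧
  List.Forall₂ (fun s s' => Nonempty (s.1.pom.Iso s'.1.pom) ∧ s.2 = s'.2) w.steps w'.steps ∧
  Nonempty (w.J.pom.Iso w'.J.pom)

/-! ### Timed ipomsets -/

/-- Timed ipomsets; `[lo x, hi x]` is the activity interval of `x` and `dur` the duration. -/
structure Tipomset (α : Type u) extends Ipomset α where
  lo : Ev → ℝ≥0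
  hi : Ev → ℝ≥0
  dur : ℝ≥0
  lo_le_hi : ∀ x, lo x ≤ hi x
  hi_le_dur : ∀ x, hi x ≤ dur
  lo_S : ∀ x ∈ S, lo x = 0
  hi_T : ∀ x ∈ T, hi x = dur
  lt_of_hi_lt_lo : ∀ x y, hi x < lo y → lt x y
  hi_le_lo_of_lt : ∀ x y, lt x y → hi x ≤ lo y

/-- Isomorphisms of timed ipomsets. -/
structure Tipomset.Iso {α : Type u} (P Q : Tipomset α)
    extends Ipomset.Iso P.toIpomset Q.toIpomset where
  map_lo : ∀ x, Q.lo (map x) = P.lo x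
  map_hi : ∀ x, Q.hi (map x) = P.hi x
  dur_eq : P.dur = Q.dur

instance Tipomset.setoid (α : Type u) : Setoid (Tipomset α) where
  r P Q := Nonempty (P.Iso Q)
  iseqv :=
    { refl := fun _ => ⟨⟨.refl _, fun _ => rfl, fun _ => rfl, rfl⟩⟩
      symm := fun ⟨f⟩ => ⟨⟨f.toIso.symm,
        fun x => by simpa [Ipomset.Iso.symm] using (f.map_lo (f.map.symm x)).symm,
        fun x => by simpa [Ipomset.Iso.symm] using (f.map_hi (f.map.symm x)).symm,
        f.dur_eq.symm⟩⟩
      trans := fun ⟨f⟩ ⟨g⟩ => ⟨⟨f.toIso.trans g.toIso,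
        fun x => (g.map_lo _).trans (f.map_lo x),
        fun x => (g.map_hi _).trans (f.map_hi x),
        f.dur_eq.trans g.dur_eq⟩⟩ }

/-- The set of timed ipomsets, up to isomorphism. -/
def TiPoms (α : Type u) := Quotient (Tipomset.setoid α)

/-! ### The map `tGlue` -/

/-- A gluing `P₀ * P₁ * … * Pₙ` with first factor `P₀ = P`; `mem i` is the set of those events
which belong to `Pᵢ`. -/
structure Glued {α : Type u} (P : Ipomset α) where
  pom : Ipomset α
  mem : ℕ → Set pom.Ev
  composable : ∀ O : Ipomset α, O.Composable P → O.Composable pom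

/-- The gluing `P * l₁ * … * lₙ`, bracketed to the right. -/
noncomputable def glueList {α : Type u} : (P : Ipomset α) → (l : List (Ipomset α)) →
    List.IsChain Ipomset.Composable (P :: l) → Glued P
  | P, [], _ => ⟨P, fun i => {_ev | i = 0}, fun _ h => h⟩
  | P, Q :: l, h =>
    let R := glueList Q l h.tail
    let m : P.Iface R.pom := Classical.choice (R.composable P (List.isChain_cons_cons.1 h).1)
    ⟨P.glue R.pom m,
      fun i => match i with
        | 0 => Set.range m.inP
        | i + 1 => m.inQ '' R.mem i,
      fun _ hO => Ipomset.composable_glue m hO⟩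

section GlueList

variable {α : Type u}

theorem glueList_mem_le (P : Ipomset α) (l : List (Ipomset α))
    (h : List.IsChain Ipomset.Composable (P :: l)) (x : (glueList P l h).pom.Ev) (i : ℕ)
    (hx : x ∈ (glueList P l h).mem i) : i ≤ l.length := by
  induction l generalizing P i with
  | nil => exact le_of_eq hx
  | cons Q l ih =>
    cases i with
    | zero => simp
    | succ i =>
      obtain ⟨y, hy, rfl⟩ := hx
      simpa using ih Q h.tail y i hy

theorem glueList_mem_exists (P : Ipomset α) (l : List (Ipomset α))
    (h : List.IsChain Ipomset.Composable (P :: l)) (x : (glueList P l h).pom.Ev) :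
    ∃ i, x ∈ (glueList P l h).mem i := by
  induction l generalizing P with
  | nil => exact ⟨0, rfl⟩
  | cons Q l ih =>
    rcases Ipomset.Iface.cases _ x with ⟨p, hp⟩ | ⟨q, _, hq⟩
    · exact ⟨0, p, hp.symm⟩
    · obtain ⟨i, hi⟩ := ih Q h.tail q
      exact ⟨i + 1, q, hi, hq.symm⟩

theorem glueList_S (P : Ipomset α) (l : List (Ipomset α))
    (h : List.IsChain Ipomset.Composable (P :: l)) (x : (glueList P l h).pom.Ev)
    (hx : x ∈ (glueList P l h).pom.S) : x ∈ (glueList P l h).mem 0 := by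
  cases l with
  | nil => exact rfl
  | cons Q l =>
    obtain ⟨p, _, hp⟩ := hx
    exact ⟨p, hp⟩

theorem glueList_T (P : Ipomset α) (l : List (Ipomset α))
    (h : List.IsChain Ipomset.Composable (P :: l)) (x : (glueList P l h).pom.Ev)
    (hx : x ∈ (glueList P l h).pom.T) : x ∈ (glueList P l h).mem l.length := by
  induction l generalizing P with
  | nil => exact rfl
  | cons Q l ih =>
    obtain ⟨q, hq, hq'⟩ := hx
    exact ⟨q, ih Q h.tail q hq, hq'⟩

theorem glueList_lt (P : Ipomset α) (l : List (Ipomset α))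
    (h : List.IsChain Ipomset.Composable (P :: l)) (hd : ∀ Q ∈ P :: l, Q.IsDiscrete)
    (x y : (glueList P l h).pom.Ev) :
    (glueList P l h).pom.lt x y ↔
      ∀ i j, x ∈ (glueList P l h).mem i → y ∈ (glueList P l h).mem j → i < j := by
  induction l generalizing P with
  | nil =>
    constructor
    · intro hxy
      exact (hd P (by simp) x y hxy).elim
    · intro hxy
      exact absurd (hxy 0 0 rfl rfl) (lt_irrefl 0)
  | cons Q l ih =>
    have ih' := ih Q h.tail (fun R hR => hd R (List.mem_cons_of_mem _ hR))
    set R := glueList Q l h.tail with hR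
    let m : P.Iface R.pom := Classical.choice (R.composable P (List.isChain_cons_cons.1 h).1)
    change m.glt x y ↔ _
    have m0 : ∀ z : m.GEv, z ∈ (glueList P (Q :: l) h).mem 0 ↔ z ∈ Set.range m.inP :=
      fun z => Iff.rfl
    have ms : ∀ (i : ℕ) (z : m.GEv),
        z ∈ (glueList P (Q :: l) h).mem (i + 1) ↔ z ∈ m.inQ '' R.mem i := fun i z => Iff.rfl
    constructor
    · rintro (⟨p, p', hp, _, _⟩ | ⟨q, q', hq, rfl, rfl⟩ | ⟨p, q, hp, hq, rfl, rfl⟩) i j hi hj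
      · exact (hd P (by simp) p p' hp).elim
      · cases j with
        | zero =>
          obtain ⟨p, hp⟩ := (m0 _).1 hj
          obtain ⟨_, rfl⟩ := m.inQ_eq_inP hp.symm
          exact (R.pom.S_minimal _ (m.e _).2 _ hq).elim
        | succ j =>
          cases i with
          | zero => omega
          | succ i =>
            obtain ⟨a, ha, ha'⟩ := (ms i _).1 hi
            obtain ⟨b, hb, hb'⟩ := (ms j _).1 hj
            rw [m.inQ_injective ha'] at ha
            rw [m.inQ_injective hb'] at hb
            have := (ih' q q').1 hq i j ha hb
            omega
      · cases j with
        | zero =>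
          obtain ⟨p, hp⟩ := (m0 _).1 hj
          obtain ⟨_, rfl⟩ := m.inQ_eq_inP hp.symm
          exact (hq (m.e _).2).elim
        | succ j =>
          cases i with
          | zero => omega
          | succ i =>
            obtain ⟨a, ha, ha'⟩ := (ms i _).1 hi
            exact (hp (m.inQ_eq_inP ha').1).elim
    · intro hxy
      have key : ∀ q q', x = m.inQ q → y = m.inQ q' → m.glt x y := by
        rintro q q' rfl rfl
        refine (m.glt_inQ _ _).2 ((ih' q q').2 (fun i j hi hj => ?_))
        have := hxy (i + 1) (j + 1) ((ms i _).2 ⟨q, hi, rfl⟩) ((ms j _).2 ⟨q', hj, rfl⟩)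
        omega
      rcases m.cases y with ⟨p', rfl⟩ | ⟨q', hq', rfl⟩
      · obtain ⟨i, hi⟩ := glueList_mem_exists P (Q :: l) h x
        exact absurd (hxy i 0 hi ((m0 _).2 ⟨p', rfl⟩)) (Nat.not_lt_zero _)
      · rcases m.cases x with ⟨p, rfl⟩ | ⟨q, hq, rfl⟩
        · by_cases hp : p ∈ P.T
          · exact key (m.e ⟨p, hp⟩) q' (m.inQ_e ⟨p, hp⟩).symm rfl
          · exact m.glt_inP_inQ hp hq'
        · exact key q q' rfl rfl

end GlueList

/-- The index of the first factor an event belongs to. -/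
noncomputable def Glued.first {α : Type u} {P : Ipomset α} (G : Glued P) (x : G.pom.Ev) : ℕ :=
  sInf {i | x ∈ G.mem i}

/-- The index of the last factor an event belongs to. -/
noncomputable def Glued.last {α : Type u} {P : Ipomset α} (G : Glued P) (x : G.pom.Ev) : ℕ :=
  sSup {i | x ∈ G.mem i}

theorem glueList_first_mem {α : Type u} (P : Ipomset α) (l : List (Ipomset α))
    (h : List.IsChain Ipomset.Composable (P :: l)) (x : (glueList P l h).pom.Ev) :
    x ∈ (glueList P l h).mem ((glueList P l h).first x) :=
  Nat.sInf_mem (s := {i | x ∈ (glueList P l h).mem i}) (glueList_mem_exists P l h x)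

theorem glueList_bddAbove {α : Type u} (P : Ipomset α) (l : List (Ipomset α))
    (h : List.IsChain Ipomset.Composable (P :: l)) (x : (glueList P l h).pom.Ev) :
    BddAbove {i | x ∈ (glueList P l h).mem i} :=
  ⟨l.length, fun i hi => glueList_mem_le P l h x i hi⟩

theorem glueList_last_mem {α : Type u} (P : Ipomset α) (l : List (Ipomset α))
    (h : List.IsChain Ipomset.Composable (P :: l)) (x : (glueList P l h).pom.Ev) :
    x ∈ (glueList P l h).mem ((glueList P l h).last x) :=
  Nat.sSup_mem (s := {i | x ∈ (glueList P l h).mem i}) (glueList_mem_exists P l h x)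
    (glueList_bddAbove P l h x)

theorem sum_take_mono (ds : List ℝ≥0) {i j : ℕ} (h : i ≤ j) :
    (ds.take i).sum ≤ (ds.take j).sum :=
  ((List.take_sublist_take_left h).sum_le_sum (fun _ _ => zero_le))

theorem sum_take_le (ds : List ℝ≥0) (i : ℕ) : (ds.take i).sum ≤ ds.sum :=
  (List.take_sublist i ds).sum_le_sum (fun _ _ => zero_le)

section TGlue

variable {α : Type u}

/-- The gluing of `I₀, P₁, …, Pₙ, Iₙ₊₁`, as factors number `0, …, n + 1`. (The identities are
neutral; they also make sense of the case `n = 0`.) -/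
noncomputable def SparseIdw.glued (w : SparseIdw α) : Glued w.I.pom :=
  glueList w.I.pom (w.steps.map (fun s => s.1.pom) ++ [w.J.pom]) w.coherent

/-- The delays `d₀, …, dₙ`. -/
def SparseIdw.delays (w : SparseIdw α) : List ℝ≥0 := w.d₀ :: w.steps.map Prod.snd

theorem SparseIdw.discrete (w : SparseIdw α) :
    ∀ Q ∈ w.I.pom :: (w.steps.map (fun s => s.1.pom) ++ [w.J.pom]), Q.IsDiscrete := by
  intro Q hQ
  simp only [List.mem_cons, List.mem_append, List.mem_map, List.not_mem_nil, or_false] at hQ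
  rcases hQ with rfl | ⟨s, _, rfl⟩ | rfl
  · exact w.I.isId.1.1
  · exact s.1.isDiscrete
  · exact w.J.isId.1.1

/-- The timed ipomset of a sparse form: an event `x` starts at time `∑ i < first x, dᵢ` (that is,
at `0` if `first x = 0`) and ends at time `∑ i < last x, dᵢ` (that is, at the total duration
`∑ i < n + 1, dᵢ` if `last x = n + 1`). -/
noncomputable def SparseIdw.tGlue (w : SparseIdw α) : Tipomset α where
  toIpomset := w.glued.pom
  lo x := (w.delays.take (w.glued.first x)).sum
  hi x := (w.delays.take (w.glued.last x)).sum
  dur := w.delays.sum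
  lo_le_hi x := sum_take_mono _
    (le_csSup (glueList_bddAbove _ _ w.coherent x) (glueList_first_mem _ _ w.coherent x))
  hi_le_dur x := sum_take_le _ _
  lo_S x hx := by
    have : w.glued.first x = 0 := Nat.le_zero.1 (Nat.sInf_le (glueList_S _ _ w.coherent x hx))
    simp [this]
  hi_T x hx := by
    have h1 := glueList_T _ _ w.coherent x hx
    have h2 : _ ≤ w.glued.last x := le_csSup (glueList_bddAbove _ _ w.coherent x) h1
    rw [List.take_of_length_le]
    simpa [SparseIdw.delays] using h2
  lt_of_hi_lt_lo x y hxy := by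
    refine (glueList_lt _ _ w.coherent w.discrete x y).2 (fun i j hi hj => ?_)
    have h1 : i ≤ w.glued.last x := le_csSup (glueList_bddAbove _ _ w.coherent x) hi
    have h2 : w.glued.first y ≤ j := Nat.sInf_le hj
    have h3 : w.glued.last x < w.glued.first y := by
      by_contra hc
      exact absurd hxy (not_lt.2 (sum_take_mono _ (not_lt.1 hc)))
    omega
  hi_le_lo_of_lt x y hxy := sum_take_mono _
    ((glueList_lt _ _ w.coherent w.discrete x y).1 hxy _ _
      (glueList_last_mem _ _ w.coherent x) (glueList_first_mem _ _ w.coherent y)).le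

end TGlue

end TimedConc

/-! A delay word is read as an operator on timed ipomsets, applied from the right end of the word to
the final identity `J`. A delay `d` moves all ends, and all starts outside the source interface,
later by `d`. A starter or terminator is glued in front and takes no time. This defines the relation
`Sem`. Each generating relation of the congruence equates two strings with the same action; for the
rules on steps this is associativity of gluing and neutrality of identities. Hence `Sem` is
invariant under the congruence (`Cong.sem_iff`). It determines its timed ipomset up to isomorphism
(`Sem.iso`), and for a sparse word this is the image under `tGlue` (`SparseIdw.sem_tGlue`). One
subtlety: the congruence concerns inner words only, so it may insert at their end an identity which
does not fit `J`; this is why `Sem` allows identities to be skipped.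

The rest is about peeling the first letters off a timed ipomset. The first delay is the earliest
time at which an event outside the source interface starts or an event outside the target interface
ends. Once this delay is removed, two kinds of events decide the first step: new events at time `0`
without predecessor (`Starts`), and source events ending at `0` before every new event (`Ends`).
They cannot coexist, since the latter would precede the former. If the first step is a starter, it
consists of the source interface and, by sparsity, of all events which start; if it is a terminator,
it ends all events which end. So the delay, the step and the remainder are determined, and induction
gives `sparse_unique`. This yields both uniqueness of sparse representatives and injectivity of
`tGlue`.

For surjectivity, the interval order ensures that peeling never gets stuck: if something happens at
time `0` but nothing can start, then something can end (`Tipomset.Active.exists_ends`). Every proper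
step lowers the number of remaining starts and ends, so a word for the timed ipomset is found
(`exists_sem`), and `exists_sparse` makes it sparse by merging from the right. -/

namespace TimedConc

variable {α : Type u}

/-! ### Equivalences from maps with equal ranges or kernels -/

/-- Compares two presentations of one subset of `Y`, such as an interface seen from both factors of
a gluing. -/
theorem exists_equiv_of_range_eq {A B Y : Type*} {f : A → Y} {g : B → Y}
    (hf : Function.Injective f) (hg : Function.Injective g) (h : Set.range f = Set.range g) :
    ∃ e : A ≃ B, ∀ a, g (e a) = f a := by
  refine ⟨((Equiv.ofInjective f hf).trans (Equiv.setCongr h)).trans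
    (Equiv.ofInjective g hg).symm, fun a => ?_⟩
  simp [Equiv.apply_ofInjective_symm]

/-- Serves as the universal property of the union of the events of two factors: `F` is then the map
from the disjoint sum onto the union. -/
theorem exists_injective_of_ker_eq {A R X : Type*} {F : A → R} {G : A → X}
    (hF : Function.Surjective F) (h : ∀ a b, F a = F b ↔ G a = G b) :
    ∃ k : R → X, Function.Injective k ∧ ∀ a, k (F a) = G a := by
  choose s hs using hF
  refine ⟨fun r => G (s r), fun r r' hr => ?_, fun a => (h _ _).1 (hs _)⟩
  rw [← hs r, ← hs r']
  exact (h _ _).2 hr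

/-! ### Event orders on interfaces -/

theorem Ipomset.lt_asymm (P : Ipomset α) {x y : P.Ev} (h : P.lt x y) : ¬ P.lt y x :=
  fun h' => P.lt_irrefl x (P.lt_trans _ _ _ h h')

theorem Ipomset.Iso.map_ev_of_T {P Q : Ipomset α} (f : P.Iso Q) {x y : P.Ev} (hx : x ∈ P.T)
    (hy : y ∈ P.T) : P.ev x y ↔ Q.ev (f.map x) (f.map y) :=
  f.map_ev _ _ (P.T_maximal _ hx _) (P.T_maximal _ hy _)

theorem Ipomset.Iso.map_ev_of_S {P Q : Ipomset α} (f : P.Iso Q) {x y : P.Ev} (hx : x ∈ P.S)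
    (hy : y ∈ P.S) : P.ev x y ↔ Q.ev (f.map x) (f.map y) :=
  f.map_ev _ _ (P.S_minimal _ hy _) (P.S_minimal _ hx _)

/-- Conclists are rigid: there is at most one identification of interfaces. -/
instance Ipomset.Iface.subsingleton (P Q : Ipomset α) : Subsingleton (P.Iface Q) := by
  refine ⟨fun m m' => ?_⟩
  have := P.finite
  have := Q.finite
  let r : P.T → P.T → Prop := fun x y => P.ev x y
  let s : Q.S → Q.S → Prop := fun x y => Q.ev x y
  have : IsTrans P.T r := ⟨fun _ _ _ => P.ev_trans _ _ _⟩
  have : Std.Irrefl r := ⟨fun _ => P.ev_irrefl _⟩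
  have : Std.Irrefl s := ⟨fun _ => Q.ev_irrefl _⟩
  have : IsWellFounded P.T r := ⟨Finite.wellFounded_of_trans_of_irrefl r⟩
  have : Std.Trichotomous s := ⟨fun x y h h' => by
    by_contra hxy
    rcases Q.ordered x y (fun h => hxy (Subtype.ext h)) with k | k | k | k
    · exact Q.S_minimal _ y.2 _ k
    · exact Q.S_minimal _ x.2 _ k
    · exact h k
    · exact h' k⟩
  let f : r ≃r s := ⟨m.e, fun {a b} => (m.ev_iff a b).symm⟩
  let g : r ≃r s := ⟨m'.e, fun {a b} => (m'.ev_iff a b).symm⟩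
  -- Initial embeddings of a well-founded relation into a trichotomous one are unique.
  -- Well-foundedness comes from finiteness, trichotomy from the minimality of the events of `Q.S`.
  have h : f.toInitialSeg = g.toInitialSeg := Subsingleton.elim _ _
  have h' : m.e = m'.e := by
    ext x
    exact congrArg Subtype.val (DFunLike.congr_fun h x)
  cases m
  cases m'
  cases h'
  rfl

/-! ### Gluings, characterised up to isomorphism -/

/-- `Y` is the gluing of `P` and `Q`, with inclusions `i` and `j`. -/
structure IsGlue (P Q Y : Ipomset α) (i : P.Ev → Y.Ev) (j : Q.Ev → Y.Ev) : Prop where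
  inj_i : Function.Injective i
  inj_j : Function.Injective j
  surj : ∀ y, y ∈ Set.range i ∨ y ∈ Set.range j
  mem_T : ∀ p, p ∈ P.T ↔ i p ∈ Set.range j
  mem_S : ∀ q, q ∈ Q.S ↔ j q ∈ Set.range i
  lab_i : ∀ p, Y.lab (i p) = P.lab p
  lab_j : ∀ q, Y.lab (j q) = Q.lab q
  lt_i : ∀ p p', Y.lt (i p) (i p') ↔ P.lt p p'
  lt_j : ∀ q q', Y.lt (j q) (j q') ↔ Q.lt q q'
  lt_ij : ∀ p q, p ∉ P.T → q ∉ Q.S → Y.lt (i p) (j q)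
  ev_i : ∀ p p', ¬ P.lt p p' → ¬ P.lt p' p → (Y.ev (i p) (i p') ↔ P.ev p p')
  ev_j : ∀ q q', ¬ Q.lt q q' → ¬ Q.lt q' q → (Y.ev (j q) (j q') ↔ Q.ev q q')
  S_eq : Y.S = i '' P.S
  T_eq : Y.T = j '' Q.T

/-- Links the concrete sum type with the description `IsGlue`, which is stable under isomorphism
because it constrains the event order on incomparable events only. -/
theorem Ipomset.Iface.isGlue {P Q : Ipomset α} (m : P.Iface Q) :
    IsGlue P Q (P.glue Q m) m.inP m.inQ where
  inj_i := m.inP_injective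
  inj_j := m.inQ_injective
  surj y := by
    rcases m.cases y with ⟨p, rfl⟩ | ⟨q, _, rfl⟩
    · exact Or.inl ⟨p, rfl⟩
    · exact Or.inr ⟨q, rfl⟩
  mem_T p := ⟨fun h => ⟨m.e ⟨p, h⟩, m.inQ_e ⟨p, h⟩⟩, fun ⟨_, h⟩ => (m.inQ_eq_inP h).1⟩
  mem_S q := by
    refine ⟨fun h => ⟨_, (m.inQ_of_mem h).symm⟩, fun ⟨_, h⟩ => ?_⟩
    obtain ⟨_, rfl⟩ := m.inQ_eq_inP h.symm
    exact (m.e _).2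
  lab_i _ := rfl
  lab_j q := by
    by_cases h : q ∈ Q.S
    · rw [m.inQ_of_mem h]
      exact (m.lab_eq _).trans (by simp)
    · rw [m.inQ_of_not_mem h]
      rfl
  lt_i := m.glt_inP
  lt_j := m.glt_inQ
  lt_ij _ _ hp hq := m.glt_inP_inQ hp hq
  ev_i p p' _ _ := m.gev_inP p p'
  ev_j q q' _ _ := m.gev_inQ q q'
  S_eq := rfl
  T_eq := rfl

namespace IsGlue

variable {P Q Y : Ipomset α} {i : P.Ev → Y.Ev} {j : Q.Ev → Y.Ev}

theorem mem_S_i (h : IsGlue P Q Y i j) (p : P.Ev) : i p ∈ Y.S ↔ p ∈ P.S := by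
  rw [h.S_eq, h.inj_i.mem_set_image]

theorem mem_T_j (h : IsGlue P Q Y i j) (q : Q.Ev) : j q ∈ Y.T ↔ q ∈ Q.T := by
  rw [h.T_eq, h.inj_j.mem_set_image]

theorem not_mem_S_j (h : IsGlue P Q Y i j) {q : Q.Ev} (hq : q ∉ Q.S) : j q ∉ Y.S := by
  rw [h.S_eq]
  rintro ⟨p, _, hp⟩
  exact hq ((h.mem_S q).2 ⟨p, hp⟩)

theorem not_mem_T_i (h : IsGlue P Q Y i j) {p : P.Ev} (hp : p ∉ P.T) : i p ∉ Y.T := by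
  rw [h.T_eq]
  rintro ⟨q, _, hq⟩
  exact hp ((h.mem_T p).2 ⟨q, hq⟩)

theorem exists_of_mem_T (h : IsGlue P Q Y i j) {p : P.Ev} (hp : p ∈ P.T) :
    ∃ q ∈ Q.S, j q = i p := by
  obtain ⟨q, hq⟩ := (h.mem_T p).1 hp
  exact ⟨q, (h.mem_S q).2 ⟨p, hq.symm⟩, hq⟩

theorem exists_of_mem_S (h : IsGlue P Q Y i j) {q : Q.Ev} (hq : q ∈ Q.S) :
    ∃ p ∈ P.T, i p = j q := by
  obtain ⟨p, hp⟩ := (h.mem_S q).1 hq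
  exact ⟨p, (h.mem_T p).2 ⟨q, hp.symm⟩, hp⟩

theorem cases_i (h : IsGlue P Q Y i j) (y : Y.Ev) : (∃ p, i p = y) ∨ ∃ q, q ∉ Q.S ∧ j q = y := by
  rcases h.surj y with k | ⟨q, rfl⟩
  · exact Or.inl k
  · by_cases hq : q ∈ Q.S
    · obtain ⟨p, _, hp⟩ := h.exists_of_mem_S hq
      exact Or.inl ⟨p, hp⟩
    · exact Or.inr ⟨q, hq, rfl⟩

theorem cases_j (h : IsGlue P Q Y i j) (y : Y.Ev) : (∃ p, p ∉ P.T ∧ i p = y) ∨ ∃ q, j q = y := by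
  rcases h.surj y with ⟨p, rfl⟩ | k
  · by_cases hp : p ∈ P.T
    · obtain ⟨q, _, hq⟩ := h.exists_of_mem_T hp
      exact Or.inr ⟨q, hq⟩
    · exact Or.inl ⟨p, hp, rfl⟩
  · exact Or.inr k

theorem not_lt_ji (h : IsGlue P Q Y i j) {p : P.Ev} {q : Q.Ev} (hq : q ∉ Q.S) :
    ¬ Y.lt (j q) (i p) := by
  by_cases hp : p ∈ P.T
  · obtain ⟨q', hq', e⟩ := h.exists_of_mem_T hp
    rw [← e, h.lt_j]
    exact Q.S_minimal _ hq' _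
  · exact Y.lt_asymm (h.lt_ij p q hp hq)

theorem pair_cases (h : IsGlue P Q Y i j) (x y : Y.Ev) :
    (∃ p p', i p = x ∧ i p' = y) ∨ (∃ q q', j q = x ∧ j q' = y) ∨
    (∃ p q, p ∉ P.T ∧ q ∉ Q.S ∧ i p = x ∧ j q = y) ∨
    ∃ p q, p ∉ P.T ∧ q ∉ Q.S ∧ j q = x ∧ i p = y := by
  rcases h.cases_i x with ⟨p, rfl⟩ | ⟨q, hq, rfl⟩
  · rcases h.cases_i y with ⟨p', rfl⟩ | ⟨q', hq', rfl⟩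
    · exact Or.inl ⟨p, p', rfl, rfl⟩
    · by_cases hp : p ∈ P.T
      · obtain ⟨q, _, e⟩ := h.exists_of_mem_T hp
        exact Or.inr (Or.inl ⟨q, q', e, rfl⟩)
      · exact Or.inr (Or.inr (Or.inl ⟨p, q', hp, hq', rfl, rfl⟩))
  · rcases h.cases_j y with ⟨p, hp, rfl⟩ | ⟨q', rfl⟩
    · exact Or.inr (Or.inr (Or.inr ⟨p, q, hp, hq, rfl, rfl⟩))
    · exact Or.inr (Or.inl ⟨q, q', rfl, rfl⟩)

theorem exists_iface (h : IsGlue P Q Y i j) : ∃ m : P.Iface Q, ∀ t : P.T, j (m.e t) = i t := by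
  obtain ⟨e, he⟩ := exists_equiv_of_range_eq (f := fun t : P.T => i t) (g := fun s : Q.S => j s)
    (h.inj_i.comp Subtype.val_injective) (h.inj_j.comp Subtype.val_injective) (by
      ext y
      constructor
      · rintro ⟨t, rfl⟩
        obtain ⟨q, hq, e⟩ := h.exists_of_mem_T t.2
        exact ⟨⟨q, hq⟩, e⟩
      · rintro ⟨s, rfl⟩
        obtain ⟨p, hp, e⟩ := h.exists_of_mem_S s.2
        exact ⟨⟨p, hp⟩, e⟩)
  refine ⟨⟨e, fun t => ?_, fun t t' => ?_⟩, he⟩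
  · rw [← h.lab_i, ← h.lab_j]
    exact congrArg Y.lab (he t).symm
  · rw [← h.ev_i _ _ (P.T_maximal _ t.2 _) (P.T_maximal _ t'.2 _),
      ← h.ev_j _ _ (Q.S_minimal _ (e t').2 _) (Q.S_minimal _ (e t).2 _)]
    exact iff_of_eq (congrArg₂ Y.ev (he t).symm (he t').symm)

theorem composable (h : IsGlue P Q Y i j) : P.Composable Q :=
  ⟨h.exists_iface.choose⟩

/-- As interfaces are unique, which events of the two factors coincide does not depend on `Y`.
Uniqueness and associativity of gluings rest on this. -/
theorem eq_iff (h : IsGlue P Q Y i j) (m : P.Iface Q) (p : P.Ev) (q : Q.Ev) :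
    i p = j q ↔ ∃ hp : p ∈ P.T, (m.e ⟨p, hp⟩ : Q.Ev) = q := by
  obtain ⟨m', hm⟩ := h.exists_iface
  rw [Subsingleton.elim m m']
  constructor
  · intro e
    have hp := (h.mem_T p).2 ⟨q, e.symm⟩
    exact ⟨hp, h.inj_j ((hm ⟨p, hp⟩).trans e)⟩
  · rintro ⟨hp, rfl⟩
    exact (hm ⟨p, hp⟩).symm

/-- Interfaces with `P` on the right extend to `P * Q`. -/
theorem exists_iface_right (h : IsGlue P Q Y i j) {O : Ipomset α} (m : O.Iface P) :
    ∃ m' : O.Iface Y, ∀ t : O.T, (m'.e t : Y.Ev) = i (m.e t) := by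
  refine ⟨⟨m.e.trans ((Equiv.Set.image i P.S h.inj_i).trans (Equiv.setCongr h.S_eq.symm)),
    fun t => ?_, fun t t' => ?_⟩, fun t => rfl⟩
  · exact (m.lab_eq t).trans (h.lab_i _).symm
  · exact (m.ev_iff t t').trans
      (h.ev_i _ _ (P.S_minimal _ (m.e t').2 _) (P.S_minimal _ (m.e t).2 _)).symm

theorem composable_right (h : IsGlue P Q Y i j) {O : Ipomset α} (k : O.Composable P) :
    O.Composable Y :=
  k.elim fun m => ⟨(h.exists_iface_right m).choose⟩

theorem composable_left (h : IsGlue P Q Y i j) {O : Ipomset α} (k : Q.Composable O) :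
    Y.Composable O := by
  obtain ⟨m⟩ := k
  obtain ⟨e, he⟩ := exists_equiv_of_range_eq (f := fun y : Y.T => (y : Y.Ev))
    (g := fun t : Q.T => j t) Subtype.val_injective (h.inj_j.comp Subtype.val_injective) (by
      ext y
      simp [h.T_eq])
  refine ⟨⟨e.trans m.e, fun y => ?_, fun y y' => ?_⟩⟩
  · rw [← he y, h.lab_j]
    exact m.lab_eq _
  · rw [← he y, ← he y', h.ev_j _ _ (Q.T_maximal _ (e y).2 _) (Q.T_maximal _ (e y').2 _)]
    exact m.ev_iff _ _

/-- Maps out of a gluing. -/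
theorem exists_lift (h : IsGlue P Q Y i j) {X : Type*} {c : P.Ev → X} {d : Q.Ev → X}
    (hc : Function.Injective c) (hd : Function.Injective d)
    (hcd : ∀ p q, i p = j q ↔ c p = d q) :
    ∃ k : Y.Ev → X, Function.Injective k ∧ (∀ p, k (i p) = c p) ∧ ∀ q, k (j q) = d q := by
  obtain ⟨k, hk, e⟩ := exists_injective_of_ker_eq (F := Sum.elim i j) (G := Sum.elim c d)
    (fun y => by
      rcases h.surj y with ⟨p, rfl⟩ | ⟨q, rfl⟩
      · exact ⟨Sum.inl p, rfl⟩
      · exact ⟨Sum.inr q, rfl⟩)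
    (by
      rintro (p | q) (p' | q')
      · simp [h.inj_i.eq_iff, hc.eq_iff]
      · exact hcd p q'
      · exact eq_comm.trans ((hcd p' q).trans eq_comm)
      · simp [h.inj_j.eq_iff, hd.eq_iff])
  exact ⟨k, hk, fun p => e (Sum.inl p), fun q => e (Sum.inr q)⟩

/-- Gluings are unique up to isomorphism. -/
theorem exists_iso (h : IsGlue P Q Y i j) {Y' : Ipomset α} {i' : P.Ev → Y'.Ev} {j' : Q.Ev → Y'.Ev}
    (h' : IsGlue P Q Y' i' j') :
    ∃ f : Y.Iso Y', (∀ p, f.map (i p) = i' p) ∧ ∀ q, f.map (j q) = j' q := by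
  obtain ⟨m, -⟩ := h.exists_iface
  obtain ⟨k, hk, ki, kj⟩ := h.exists_lift h'.inj_i h'.inj_j
    (fun p q => (h.eq_iff m p q).trans (h'.eq_iff m p q).symm)
  have hs : Function.Surjective k := fun y => by
    rcases h'.surj y with ⟨p, rfl⟩ | ⟨q, rfl⟩
    exacts [⟨_, ki p⟩, ⟨_, kj q⟩]
  refine ⟨⟨Equiv.ofBijective k ⟨hk, hs⟩, fun x => ?_, fun x => ?_, fun x => ?_, fun x y => ?_,
    fun x y => ?_⟩, ki, kj⟩
  · change k x ∈ _ ↔ _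
    rcases h.cases_i x with ⟨p, rfl⟩ | ⟨q, hq, rfl⟩
    · rw [ki, h.mem_S_i, h'.mem_S_i]
    · rw [kj]
      exact iff_of_false (h'.not_mem_S_j hq) (h.not_mem_S_j hq)
  · change k x ∈ _ ↔ _
    rcases h.cases_j x with ⟨p, hp, rfl⟩ | ⟨q, rfl⟩
    · rw [ki]
      exact iff_of_false (h'.not_mem_T_i hp) (h.not_mem_T_i hp)
    · rw [kj, h.mem_T_j, h'.mem_T_j]
  · change Y'.lab (k x) = _
    rcases h.surj x with ⟨p, rfl⟩ | ⟨q, rfl⟩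
    · rw [ki, h.lab_i, h'.lab_i]
    · rw [kj, h.lab_j, h'.lab_j]
  · change Y'.lt (k x) (k y) ↔ _
    rcases h.pair_cases x y with ⟨p, p', rfl, rfl⟩ | ⟨q, q', rfl, rfl⟩ | ⟨p, q, hp, hq, rfl, rfl⟩ |
      ⟨p, q, hp, hq, rfl, rfl⟩
    · rw [ki, ki, h.lt_i, h'.lt_i]
    · rw [kj, kj, h.lt_j, h'.lt_j]
    · rw [ki, kj]
      exact iff_of_true (h'.lt_ij p q hp hq) (h.lt_ij p q hp hq)
    · rw [ki, kj]
      exact iff_of_false (h'.not_lt_ji hq) (h.not_lt_ji hq)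
  · intro h1 h2
    change _ ↔ Y'.ev (k x) (k y)
    rcases h.pair_cases x y with ⟨p, p', rfl, rfl⟩ | ⟨q, q', rfl, rfl⟩ | ⟨p, q, hp, hq, rfl, rfl⟩ |
      ⟨p, q, hp, hq, rfl, rfl⟩
    · rw [h.lt_i] at h1 h2
      rw [ki, ki, h.ev_i _ _ h1 h2, h'.ev_i _ _ h1 h2]
    · rw [h.lt_j] at h1 h2
      rw [kj, kj, h.ev_j _ _ h1 h2, h'.ev_j _ _ h1 h2]
    · exact (h1 (h.lt_ij p q hp hq)).elim
    · exact (h2 (h.lt_ij p q hp hq)).elim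

/-- Gluings are invariant under isomorphism. -/
theorem of_iso (h : IsGlue P Q Y i j) {P' Q' Y' : Ipomset α} (f : P'.Iso P) (g : Q'.Iso Q)
    (k : Y.Iso Y') :
    IsGlue P' Q' Y' (fun p => k.map (i (f.map p))) (fun q => k.map (j (g.map q))) where
  inj_i := k.map.injective.comp (h.inj_i.comp f.map.injective)
  inj_j := k.map.injective.comp (h.inj_j.comp g.map.injective)
  surj y := by
    obtain ⟨y, rfl⟩ := k.map.surjective y
    rcases h.surj y with ⟨p, rfl⟩ | ⟨q, rfl⟩
    · obtain ⟨p, rfl⟩ := f.map.surjective p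
      exact Or.inl ⟨p, rfl⟩
    · obtain ⟨q, rfl⟩ := g.map.surjective q
      exact Or.inr ⟨q, rfl⟩
  mem_T p := by
    rw [← f.map_T, h.mem_T]
    simp only [Set.mem_range, k.map.injective.eq_iff]
    exact g.map.surjective.exists
  mem_S q := by
    rw [← g.map_S, h.mem_S]
    simp only [Set.mem_range, k.map.injective.eq_iff]
    exact f.map.surjective.exists
  lab_i p := by rw [k.map_lab, h.lab_i, f.map_lab]
  lab_j p := by rw [k.map_lab, h.lab_j, g.map_lab]
  lt_i p p' := by rw [k.map_lt, h.lt_i, f.map_lt]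
  lt_j p p' := by rw [k.map_lt, h.lt_j, g.map_lt]
  lt_ij p q hp hq := by
    rw [k.map_lt]
    exact h.lt_ij _ _ (fun c => hp ((f.map_T p).1 c)) (fun c => hq ((g.map_S q).1 c))
  ev_i p p' h1 h2 := by
    rw [f.map_ev _ _ h1 h2, ← h.ev_i _ _ (by rwa [f.map_lt]) (by rwa [f.map_lt])]
    exact (k.map_ev _ _ (by rwa [h.lt_i, f.map_lt]) (by rwa [h.lt_i, f.map_lt])).symm
  ev_j p p' h1 h2 := by
    rw [g.map_ev _ _ h1 h2, ← h.ev_j _ _ (by rwa [g.map_lt]) (by rwa [g.map_lt])]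
    exact (k.map_ev _ _ (by rwa [h.lt_j, g.map_lt]) (by rwa [h.lt_j, g.map_lt])).symm
  S_eq := by
    ext y
    obtain ⟨y, rfl⟩ := k.map.surjective y
    rw [k.map_S, h.S_eq]
    simp only [Set.mem_image, k.map.injective.eq_iff]
    rw [f.map.surjective.exists]
    simp only [f.map_S]
  T_eq := by
    ext y
    obtain ⟨y, rfl⟩ := k.map.surjective y
    rw [k.map_T, h.T_eq]
    simp only [Set.mem_image, k.map.injective.eq_iff]
    rw [g.map.surjective.exists]
    simp only [g.map_T]

/-- Associativity of gluing. -/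
theorem assoc {A B R Z X : Ipomset α} {a : B.Ev → Y.Ev} {b : Z.Ev → Y.Ev} {c : A.Ev → X.Ev}
    {e : Y.Ev → X.Ev} {i : A.Ev → R.Ev} {j : B.Ev → R.Ev} (hY : IsGlue B Z Y a b)
    (hX : IsGlue A Y X c e) (hR : IsGlue A B R i j) :
    ∃ k : R.Ev → X.Ev, (∀ x, k (i x) = c x) ∧ (∀ x, k (j x) = e (a x)) ∧
      IsGlue R Z X k (fun z => e (b z)) := by
  obtain ⟨m, -⟩ := hR.exists_iface
  obtain ⟨m', hm'⟩ := hY.exists_iface_right m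
  -- The interface of `A` with `B`, extended into `Y`, is the only interface of `A` with `Y`; so `A`
  -- and `B` overlap in `R` exactly as they do in `X`.
  have hcd : ∀ p q, i p = j q ↔ c p = e (a q) := fun p q => by
    rw [hR.eq_iff m, hX.eq_iff m']
    simp only [hm', hY.inj_i.eq_iff]
  obtain ⟨k, hk, ki, kj⟩ := hR.exists_lift hX.inj_i (hX.inj_j.comp hY.inj_i) hcd
  replace kj : ∀ q, k (j q) = e (a q) := kj
  refine ⟨k, ki, kj, ?_⟩
  have nS : ∀ z, z ∉ Z.S → b z ∉ Y.S := fun z => hY.not_mem_S_j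
  constructor
  · exact hk
  · exact hX.inj_j.comp hY.inj_j
  · intro y
    rcases hX.surj y with ⟨p, rfl⟩ | ⟨y, rfl⟩
    · exact Or.inl ⟨_, ki p⟩
    · rcases hY.surj y with ⟨q, rfl⟩ | ⟨z, rfl⟩
      · exact Or.inl ⟨_, kj q⟩
      · exact Or.inr ⟨z, rfl⟩
  · intro r
    rcases hR.cases_j r with ⟨p, hp, rfl⟩ | ⟨q, rfl⟩
    · refine iff_of_false (hR.not_mem_T_i hp) ?_
      rintro ⟨z, hz⟩
      exact hp ((hX.mem_T p).2 ⟨b z, hz.trans (ki p)⟩)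
    · rw [hR.mem_T_j, hY.mem_T, kj]
      simp only [Set.mem_range, hX.inj_j.eq_iff]
  · intro z
    constructor
    · intro hz
      obtain ⟨q, _, hq⟩ := hY.exists_of_mem_S hz
      exact ⟨j q, by rw [kj, hq]⟩
    · rintro ⟨r, hr⟩
      by_contra hz
      rcases hR.surj r with ⟨p, rfl⟩ | ⟨q, rfl⟩
      · exact nS z hz ((hX.mem_S _).2 ⟨p, by rw [← hr, ki]⟩)
      · rw [kj] at hr
        exact hz ((hY.mem_S z).2 ⟨q, hX.inj_j hr⟩)
  · intro r
    rcases hR.surj r with ⟨p, rfl⟩ | ⟨q, rfl⟩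
    · rw [ki, hX.lab_i, hR.lab_i]
    · rw [kj, hX.lab_j, hY.lab_i, hR.lab_j]
  · intro z
    rw [hX.lab_j, hY.lab_j]
  · intro x y
    rcases hR.pair_cases x y with ⟨p, p', rfl, rfl⟩ | ⟨q, q', rfl, rfl⟩ | ⟨p, q, hp, hq, rfl, rfl⟩ |
      ⟨p, q, hp, hq, rfl, rfl⟩
    · rw [ki, ki, hX.lt_i, hR.lt_i]
    · rw [kj, kj, hX.lt_j, hY.lt_i, hR.lt_j]
    · rw [ki, kj]
      exact iff_of_true (hX.lt_ij _ _ hp (by rwa [hY.mem_S_i])) (hR.lt_ij _ _ hp hq)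
    · rw [ki, kj]
      exact iff_of_false (hX.not_lt_ji (by rwa [hY.mem_S_i])) (hR.not_lt_ji hq)
  · intro z z'
    rw [hX.lt_j, hY.lt_j]
  · intro r z hr hz
    rcases hR.cases_j r with ⟨p, hp, rfl⟩ | ⟨q, rfl⟩
    · rw [ki]
      exact hX.lt_ij _ _ hp (nS z hz)
    · rw [kj, hX.lt_j]
      rw [hR.mem_T_j] at hr
      exact hY.lt_ij _ _ hr hz
  · intro x y h1 h2
    rcases hR.pair_cases x y with ⟨p, p', rfl, rfl⟩ | ⟨q, q', rfl, rfl⟩ | ⟨p, q, hp, hq, rfl, rfl⟩ |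
      ⟨p, q, hp, hq, rfl, rfl⟩
    · rw [hR.lt_i] at h1 h2
      rw [ki, ki, hX.ev_i _ _ h1 h2, hR.ev_i _ _ h1 h2]
    · rw [hR.lt_j] at h1 h2
      rw [kj, kj, hX.ev_j _ _ (by rwa [hY.lt_i]) (by rwa [hY.lt_i]), hY.ev_i _ _ h1 h2,
        hR.ev_j _ _ h1 h2]
    · exact (h1 (hR.lt_ij p q hp hq)).elim
    · exact (h2 (hR.lt_ij p q hp hq)).elim
  · intro z z' h1 h2
    rw [hX.ev_j _ _ (by rwa [hY.lt_j]) (by rwa [hY.lt_j]), hY.ev_j _ _ h1 h2]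
  · rw [hX.S_eq, hR.S_eq, Set.image_image]
    simp only [ki]
  · rw [hX.T_eq, hY.T_eq, Set.image_image]

/-- Identities are neutral on the left. -/
theorem exists_iso_of_left_id (h : IsGlue P Q Y i j) (hP : P.IsId) :
    ∃ f : Q.Iso Y, ∀ q, f.map q = j q := by
  have hs : Function.Surjective j := fun y => by
    rcases h.cases_j y with ⟨p, hp, _⟩ | k
    · exact (hp (hP.1.2 ▸ Set.mem_univ p)).elim
    · exact k
  refine ⟨⟨Equiv.ofBijective j ⟨h.inj_j, hs⟩, fun q => ?_, h.mem_T_j, h.lab_j, h.lt_j,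
    fun q q' h1 h2 => (h.ev_j q q' h1 h2).symm⟩, fun q => rfl⟩
  rw [h.mem_S, h.S_eq, hP.2.2, Set.image_univ]
  rfl

/-- Identities are neutral on the right. -/
theorem exists_iso_of_right_id (h : IsGlue P Q Y i j) (hQ : Q.IsId) :
    ∃ f : P.Iso Y, ∀ p, f.map p = i p := by
  have hs : Function.Surjective i := fun y => by
    rcases h.cases_i y with k | ⟨q, hq, _⟩
    · exact k
    · exact (hq (hQ.2.2 ▸ Set.mem_univ q)).elim
  refine ⟨⟨Equiv.ofBijective i ⟨h.inj_i, hs⟩, h.mem_S_i, fun p => ?_, h.lab_i, h.lt_i,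
    fun q q' h1 h2 => (h.ev_i q q' h1 h2).symm⟩, fun q => rfl⟩
  rw [h.mem_T, h.T_eq, hQ.1.2, Set.image_univ]
  rfl

end IsGlue

/-! ### Invariance of the classes of steps -/

theorem Ipomset.Iso.isDiscrete {P Q : Ipomset α} (f : P.Iso Q) (h : P.IsDiscrete) :
    Q.IsDiscrete := fun x y k =>
  h (f.map.symm x) (f.map.symm y) ((f.map_lt _ _).1 (by simpa using k))

theorem Ipomset.Iso.isStarter {P Q : Ipomset α} (f : P.Iso Q) (h : P.IsStarter) : Q.IsStarter := by
  refine ⟨f.isDiscrete h.1, Set.eq_univ_of_forall fun x => ?_⟩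
  obtain ⟨x, rfl⟩ := f.map.surjective x
  rw [f.map_T, h.2]
  trivial

theorem Ipomset.Iso.isTerminator {P Q : Ipomset α} (f : P.Iso Q) (h : P.IsTerminator) :
    Q.IsTerminator := by
  refine ⟨f.isDiscrete h.1, Set.eq_univ_of_forall fun x => ?_⟩
  obtain ⟨x, rfl⟩ := f.map.surjective x
  rw [f.map_S, h.2]
  trivial

theorem Ipomset.Iso.isId {P Q : Ipomset α} (f : P.Iso Q) (h : P.IsId) : Q.IsId :=
  ⟨f.isStarter h.1, f.isTerminator h.2⟩

/-! ### Timed gluings and shifts -/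

/-- An isomorphism of ipomsets which preserves times is an isomorphism of timed ipomsets; the
starting times in the source interface need not be checked. -/
def Tipomset.isoOfIso {X Y : Tipomset α} (f : X.toIpomset.Iso Y.toIpomset)
    (hlo : ∀ x, x ∉ X.S → Y.lo (f.map x) = X.lo x) (hhi : ∀ x, Y.hi (f.map x) = X.hi x)
    (hdur : X.dur = Y.dur) : X.Iso Y where
  toIso := f
  map_lo x := by
    by_cases hx : x ∈ X.S
    · rw [X.lo_S x hx, Y.lo_S _ ((f.map_S x).2 hx)]
    · exact hlo x hx
  map_hi := hhi
  dur_eq := hdur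

def Tipomset.Iso.symm {X Y : Tipomset α} (f : X.Iso Y) : Y.Iso X :=
  Tipomset.isoOfIso f.toIso.symm
    (fun x _ => by simpa [Ipomset.Iso.symm] using (f.map_lo (f.map.symm x)).symm)
    (fun x => by simpa [Ipomset.Iso.symm] using (f.map_hi (f.map.symm x)).symm) f.dur_eq.symm

def Tipomset.Iso.trans {X Y Z : Tipomset α} (f : X.Iso Y) (g : Y.Iso Z) : X.Iso Z :=
  Tipomset.isoOfIso (f.toIso.trans g.toIso) (fun x _ => (g.map_lo _).trans (f.map_lo x))
    (fun x => (g.map_hi _).trans (f.map_hi x)) (f.dur_eq.trans g.dur_eq)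

def Tipomset.Iso.refl (X : Tipomset α) : X.Iso X :=
  Tipomset.isoOfIso (Ipomset.Iso.refl _) (fun _ _ => rfl) (fun _ => rfl) rfl

/-- `X` is the gluing of the step `P`, which takes no time, and the timed ipomset `Z`. -/
structure IsTGlue (P : Ipomset α) (Z X : Tipomset α) (i : P.Ev → X.Ev) (j : Z.Ev → X.Ev) : Prop
    extends IsGlue P Z.toIpomset X.toIpomset i j where
  lo_i : ∀ p, X.lo (i p) = 0
  hi_i : ∀ p, p ∉ P.T → X.hi (i p) = 0
  lo_j : ∀ z, X.lo (j z) = Z.lo z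
  hi_j : ∀ z, X.hi (j z) = Z.hi z
  dur_eq : X.dur = Z.dur

/-- Events of `P` start at `0`, which agrees with `Z` on the interface because sources of `Z` start
at `0`. Those that go on take their end from `Z`, the others end at `0`. An event starting after `0`
lies outside `P`, so the events of `P` which do not go on precede it, as they should. -/
theorem exists_isTGlue {P : Ipomset α} (hP : P.IsDiscrete) {Z : Tipomset α}
    (h : P.Composable Z.toIpomset) : ∃ (X : Tipomset α) (i : P.Ev → X.Ev) (j : Z.Ev → X.Ev),
      IsTGlue P Z X i j := by
  classical
  obtain ⟨m⟩ := h
  let lo : m.GEv → ℝ≥0 := Sum.elim (fun _ => 0) (fun q => Z.lo q)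
  let hi : m.GEv → ℝ≥0 :=
    Sum.elim (fun p => if h : p ∈ P.T then Z.hi (m.e ⟨p, h⟩) else 0) (fun q => Z.hi q)
  have g := m.isGlue
  have lo_i : ∀ p, lo (m.inP p) = 0 := fun _ => rfl
  have hi_i : ∀ p, p ∉ P.T → hi (m.inP p) = 0 := fun p hp => dif_neg hp
  have lo_j : ∀ z, lo (m.inQ z) = Z.lo z := fun z => by
    by_cases hz : z ∈ Z.S
    · rw [m.inQ_of_mem hz, lo_i, Z.lo_S z hz]
    · rw [m.inQ_of_not_mem hz]
      rfl
  have hi_j : ∀ z, hi (m.inQ z) = Z.hi z := fun z => by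
    by_cases hz : z ∈ Z.S
    · rw [m.inQ_of_mem hz]
      refine (dif_pos (m.e.symm ⟨z, hz⟩).2).trans ?_
      simp
    · rw [m.inQ_of_not_mem hz]
      rfl
  refine ⟨⟨P.glue Z.toIpomset m, lo, hi, Z.dur, fun x => ?_, fun x => ?_, ?_, ?_, fun x y => ?_,
    fun x y => ?_⟩, m.inP, m.inQ, g, lo_i, hi_i, lo_j, hi_j, rfl⟩
  · rcases g.surj x with ⟨p, rfl⟩ | ⟨q, rfl⟩
    · rw [lo_i]
      exact zero_le
    · rw [lo_j, hi_j]
      exact Z.lo_le_hi q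
  · rcases g.cases_j x with ⟨p, hp, rfl⟩ | ⟨q, rfl⟩
    · rw [hi_i p hp]
      exact zero_le
    · rw [hi_j]
      exact Z.hi_le_dur q
  · rintro _ ⟨p, _, rfl⟩
    exact lo_i p
  · rintro _ ⟨q, hq, rfl⟩
    exact (hi_j q).trans (Z.hi_T q hq)
  · intro hxy
    rcases g.pair_cases x y with ⟨p, p', rfl, rfl⟩ | ⟨q, q', rfl, rfl⟩ | ⟨p, q, hp, hq, rfl, rfl⟩ |
      ⟨p, q, hp, hq, rfl, rfl⟩
    · rw [lo_i] at hxy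
      exact (not_lt_zero hxy).elim
    · rw [lo_j, hi_j] at hxy
      exact (g.lt_j _ _).2 (Z.lt_of_hi_lt_lo _ _ hxy)
    · exact g.lt_ij p q hp hq
    · rw [lo_i] at hxy
      exact (not_lt_zero hxy).elim
  · intro hxy
    rcases g.pair_cases x y with ⟨p, p', rfl, rfl⟩ | ⟨q, q', rfl, rfl⟩ | ⟨p, q, hp, hq, rfl, rfl⟩ |
      ⟨p, q, hp, hq, rfl, rfl⟩
    · exact (hP _ _ ((g.lt_i _ _).1 hxy)).elim
    · rw [lo_j, hi_j]
      exact Z.hi_le_lo_of_lt _ _ ((g.lt_j _ _).1 hxy)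
    · rw [hi_i p hp]
      exact zero_le
    · exact (g.not_lt_ji hq hxy).elim

namespace IsTGlue

variable {P : Ipomset α} {Z X : Tipomset α} {i : P.Ev → X.Ev} {j : Z.Ev → X.Ev}

theorem of_iso (h : IsTGlue P Z X i j) {P' : Ipomset α} {Z' X' : Tipomset α} (f : P'.Iso P)
    (g : Z'.Iso Z) (k : X.Iso X') :
    IsTGlue P' Z' X' (fun p => k.map (i (f.map p))) (fun z => k.map (j (g.map z))) where
  toIsGlue := h.toIsGlue.of_iso f g.toIso k.toIso
  lo_i p := by rw [k.map_lo, h.lo_i]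
  hi_i p hp := by
    rw [k.map_hi]
    exact h.hi_i _ (fun c => hp ((f.map_T p).1 c))
  lo_j z := by rw [k.map_lo, h.lo_j, g.map_lo]
  hi_j z := by rw [k.map_hi, h.hi_j, g.map_hi]
  dur_eq := by rw [← k.dur_eq, h.dur_eq, g.dur_eq]

theorem exists_iso (h : IsTGlue P Z X i j) {X' : Tipomset α} {i' : P.Ev → X'.Ev}
    {j' : Z.Ev → X'.Ev} (h' : IsTGlue P Z X' i' j') : Nonempty (X.Iso X') := by
  obtain ⟨f, fi, fj⟩ := h.toIsGlue.exists_iso h'.toIsGlue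
  refine ⟨Tipomset.isoOfIso f (fun x _ => ?_) (fun x => ?_) (h.dur_eq.trans h'.dur_eq.symm)⟩
  · rcases h.surj x with ⟨p, rfl⟩ | ⟨q, rfl⟩
    · rw [fi, h.lo_i, h'.lo_i]
    · rw [fj, h.lo_j, h'.lo_j]
  · rcases h.cases_j x with ⟨p, hp, rfl⟩ | ⟨q, rfl⟩
    · rw [fi, h.hi_i p hp, h'.hi_i p hp]
    · rw [fj, h.hi_j, h'.hi_j]

theorem assoc {A B R : Ipomset α} {Y Z X : Tipomset α} {a : B.Ev → Y.Ev} {b : Z.Ev → Y.Ev}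
    {c : A.Ev → X.Ev} {e : Y.Ev → X.Ev} {i : A.Ev → R.Ev} {j : B.Ev → R.Ev}
    (hY : IsTGlue B Z Y a b) (hX : IsTGlue A Y X c e) (hR : IsGlue A B R i j) :
    ∃ k : R.Ev → X.Ev, IsTGlue R Z X k (fun z => e (b z)) := by
  obtain ⟨k, ki, kj, h⟩ := IsGlue.assoc hY.toIsGlue hX.toIsGlue hR
  refine ⟨k, h, fun r => ?_, fun r hr => ?_, fun z => ?_, fun z => ?_, ?_⟩
  · rcases hR.surj r with ⟨p, rfl⟩ | ⟨q, rfl⟩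
    · rw [ki, hX.lo_i]
    · rw [kj, hX.lo_j, hY.lo_i]
  · rcases hR.cases_j r with ⟨p, hp, rfl⟩ | ⟨q, rfl⟩
    · rw [ki, hX.hi_i p hp]
    · rw [kj, hX.hi_j, hY.hi_i]
      rwa [← hR.mem_T_j]
  · rw [hX.lo_j, hY.lo_j]
  · rw [hX.hi_j, hY.hi_j]
  · rw [hX.dur_eq, hY.dur_eq]

theorem exists_iso_of_isId (h : IsTGlue P Z X i j) (hP : P.IsId) : Nonempty (Z.Iso X) := by
  obtain ⟨f, hf⟩ := h.toIsGlue.exists_iso_of_left_id hP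
  refine ⟨Tipomset.isoOfIso f (fun z _ => ?_) (fun z => ?_) h.dur_eq.symm⟩
  · rw [hf, h.lo_j]
  · rw [hf, h.hi_j]

end IsTGlue

/-- `X` arises from `Z` by letting time `d` pass first. -/
structure Shift (d : ℝ≥0) (Z X : Tipomset α) extends Z.toIpomset.Iso X.toIpomset where
  map_lo : ∀ z, z ∉ Z.S → X.lo (map z) = Z.lo z + d
  map_hi : ∀ z, X.hi (map z) = Z.hi z + d
  dur_eq : X.dur = Z.dur + d

open Classical in
/-- The timed ipomset `Z` after time `d`. -/
noncomputable def Tipomset.shift (Z : Tipomset α) (d : ℝ≥0) : Tipomset α where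
  toIpomset := Z.toIpomset
  lo z := if z ∈ Z.S then 0 else Z.lo z + d
  hi z := Z.hi z + d
  dur := Z.dur + d
  lo_le_hi z := by
    split_ifs
    · exact zero_le
    · exact add_le_add_left (Z.lo_le_hi z) d
  hi_le_dur z := add_le_add_left (Z.hi_le_dur z) d
  lo_S z hz := if_pos hz
  hi_T z hz := by rw [Z.hi_T z hz]
  lt_of_hi_lt_lo x y h := by
    split_ifs at h
    · exact (not_lt_zero h).elim
    · exact Z.lt_of_hi_lt_lo x y (lt_of_add_lt_add_right h)
  hi_le_lo_of_lt x y h := by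
    -- An event with a predecessor is not in the source interface, so its start is moved as well.
    rw [if_neg (fun hy => Z.S_minimal y hy x h)]
    exact add_le_add_left (Z.hi_le_lo_of_lt x y h) d

noncomputable def Tipomset.shiftShift (Z : Tipomset α) (d : ℝ≥0) : Shift d Z (Z.shift d) where
  toIso := Ipomset.Iso.refl _
  map_lo _ hz := if_neg hz
  map_hi _ := rfl
  dur_eq := rfl

namespace Shift

variable {d d' : ℝ≥0} {X Y Z : Tipomset α}

def ofIso (f : Z.Iso X) : Shift 0 Z X where
  toIso := f.toIso
  map_lo z _ := by rw [f.map_lo, add_zero]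
  map_hi z := by rw [f.map_hi, add_zero]
  dur_eq := by rw [f.dur_eq, add_zero]

def iso (s : Shift 0 Z X) : Z.Iso X :=
  Tipomset.isoOfIso s.toIso (fun z hz => by rw [s.map_lo z hz, add_zero])
    (fun z => by rw [s.map_hi, add_zero]) (by rw [s.dur_eq, add_zero])

def trans (s : Shift d Z Y) (t : Shift d' Y X) : Shift (d + d') Z X where
  toIso := s.toIso.trans t.toIso
  map_lo z hz := (t.map_lo _ (fun c => hz ((s.map_S z).1 c))).trans (by
    rw [s.map_lo z hz, add_assoc])
  map_hi z := (t.map_hi _).trans (by rw [s.map_hi z, add_assoc])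
  dur_eq := by rw [t.dur_eq, s.dur_eq, add_assoc]

/-- A shift determines its result. -/
def isoRight (s : Shift d Z X) (t : Shift d Z Y) : X.Iso Y :=
  Tipomset.isoOfIso (s.toIso.symm.trans t.toIso)
    (fun x hx => by
      obtain ⟨z, rfl⟩ := s.map.surjective x
      have hz : z ∉ Z.S := fun c => hx ((s.map_S z).2 c)
      rw [s.map_lo z hz, ← t.map_lo z hz]
      simp [Ipomset.Iso.trans, Ipomset.Iso.symm])
    (fun x => by
      obtain ⟨z, rfl⟩ := s.map.surjective x
      rw [s.map_hi z, ← t.map_hi z]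
      simp [Ipomset.Iso.trans, Ipomset.Iso.symm])
    (by rw [s.dur_eq, t.dur_eq])

/-- Shifts can be cancelled. -/
def isoLeft (s : Shift d X Z) (t : Shift d Y Z) : X.Iso Y :=
  Tipomset.isoOfIso (s.toIso.trans t.toIso.symm)
    (fun x hx => by
      have hs := s.map_lo x hx
      obtain ⟨y, hy⟩ := t.map.surjective (s.map x)
      have hyS : y ∉ Y.S := fun c => hx ((s.map_S x).1 (hy ▸ (t.map_S y).2 c))
      rw [← hy, t.map_lo y hyS] at hs
      rw [← add_right_cancel hs]
      simp [Ipomset.Iso.trans, Ipomset.Iso.symm, ← hy])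
    (fun x => by
      have hs := s.map_hi x
      obtain ⟨y, hy⟩ := t.map.surjective (s.map x)
      rw [← hy, t.map_hi y] at hs
      rw [← add_right_cancel hs]
      simp [Ipomset.Iso.trans, Ipomset.Iso.symm, ← hy])
    (add_right_cancel (s.dur_eq.symm.trans t.dur_eq))

end Shift

/-! ### The meaning of delay words -/

/-- The timed ipomset `X` is the meaning of the delay word `w` followed by the identity `J`.
Letters act on timed ipomsets from the left: delays shift, steps are glued. Identities may also be
skipped, whether or not they fit. -/
def Sem (J : Ipomset α) : DWord α → Tipomset α → Prop
  | [], X => Nonempty (J.Iso X.toIpomset) ∧ X.dur = 0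
  | Sum.inr d :: w, X => ∃ Y, Sem J w Y ∧ Nonempty (Shift d Y X)
  | Sum.inl P :: w, X => (P.pom.IsId ∧ Sem J w X) ∨
      ∃ (Z : Tipomset α) (i : _) (j : _), Sem J w Z ∧ IsTGlue P.pom Z X i j

theorem Sem.of_iso {J J' : Ipomset α} {w : DWord α} {X X' : Tipomset α} (h : Sem J w X)
    (f : J'.Iso J) (g : X.Iso X') : Sem J' w X' := by
  induction w generalizing X X' with
  | nil =>
    obtain ⟨⟨k⟩, hd⟩ := h
    exact ⟨⟨(f.trans k).trans g.toIso⟩, g.dur_eq ▸ hd⟩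
  | cons a w ih =>
    rcases a with P | d
    · rcases h with ⟨hP, h⟩ | ⟨Z, i, j, h, hg⟩
      · exact Or.inl ⟨hP, ih h g⟩
      · exact Or.inr ⟨Z, _, _, ih h (.refl Z), hg.of_iso (.refl _) (.refl _) g⟩
    · obtain ⟨Y, hY, ⟨s⟩⟩ := h
      refine ⟨Y, ih hY (.refl Y), ⟨?_⟩⟩
      have t := s.trans (Shift.ofIso g)
      rwa [add_zero] at t

/-- Every letter acts as a partial function up to isomorphism. The two options for an identity
agree, because gluing it changes nothing; for the empty word, duration `0` forces all times to be
`0`. -/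
theorem Sem.iso {J : Ipomset α} {w : DWord α} {X X' : Tipomset α} (h : Sem J w X)
    (h' : Sem J w X') : Nonempty (X.Iso X') := by
  induction w generalizing X X' with
  | nil =>
    obtain ⟨⟨k⟩, hd⟩ := h
    obtain ⟨⟨k'⟩, hd'⟩ := h'
    have hi : ∀ (X : Tipomset α), X.dur = 0 → ∀ x, X.hi x = 0 := fun X h x =>
      le_antisymm ((X.hi_le_dur x).trans_eq h) zero_le
    have lo : ∀ (X : Tipomset α), X.dur = 0 → ∀ x, X.lo x = 0 := fun X h x =>
      le_antisymm ((X.lo_le_hi x).trans_eq (hi X h x)) zero_le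
    exact ⟨Tipomset.isoOfIso (k.symm.trans k') (fun x _ => by rw [lo _ hd, lo _ hd'])
      (fun x => by rw [hi _ hd, hi _ hd']) (hd.trans hd'.symm)⟩
  | cons a w ih =>
    rcases a with P | d
    · rcases h with ⟨hP, h⟩ | ⟨Z, i, j, h, hg⟩
      · rcases h' with ⟨hP', h'⟩ | ⟨Z', i', j', h', hg'⟩
        · exact ih h h'
        · obtain ⟨f⟩ := ih h h'
          obtain ⟨g⟩ := hg'.exists_iso_of_isId hP
          exact ⟨f.trans g⟩
      · rcases h' with ⟨hP', h'⟩ | ⟨Z', i', j', h', hg'⟩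
        · obtain ⟨f⟩ := ih h h'
          obtain ⟨g⟩ := hg.exists_iso_of_isId hP'
          exact ⟨g.symm.trans f⟩
        · obtain ⟨f⟩ := ih h h'
          exact hg.exists_iso (hg'.of_iso (.refl _) f (.refl _))
    · obtain ⟨Y, hY, ⟨s⟩⟩ := h
      obtain ⟨Y', hY', ⟨s'⟩⟩ := h'
      obtain ⟨f⟩ := ih hY hY'
      have t := (Shift.ofIso f).trans s'
      rw [zero_add] at t
      exact ⟨s.isoRight t⟩

/-! ### Invariance under the congruence -/

/-- Ensures that a merged step may be skipped in `Sem` exactly when both of its factors may. -/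
theorem isId_glue_iff {P Q Y : Ipomset α} {i : P.Ev → Y.Ev} {j : Q.Ev → Y.Ev}
    (h : IsGlue P Q Y i j) (hPQ : P.IsStarter ∧ Q.IsStarter ∨ P.IsTerminator ∧ Q.IsTerminator) :
    Y.IsId ↔ P.IsId ∧ Q.IsId := by
  constructor
  · intro hY
    have hi : ∀ p, i p ∈ Y.S := fun p => hY.2.2 ▸ Set.mem_univ _
    have hj : ∀ q, j q ∈ Y.T := fun q => hY.1.2 ▸ Set.mem_univ _
    have hPS : P.S = Set.univ := Set.eq_univ_of_forall fun p => (h.mem_S_i p).1 (hi p)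
    have hQT : Q.T = Set.univ := Set.eq_univ_of_forall fun q => (h.mem_T_j q).1 (hj q)
    have hQS : Q.S = Set.univ := by
      refine Set.eq_univ_of_forall fun q => ?_
      by_contra hq
      exact h.not_mem_S_j hq (hY.2.2 ▸ Set.mem_univ _)
    have hPT : P.T = Set.univ := by
      refine Set.eq_univ_of_forall fun p => ?_
      by_contra hp
      exact h.not_mem_T_i hp (hY.1.2 ▸ Set.mem_univ _)
    have hd : P.IsDiscrete ∧ Q.IsDiscrete := by
      rcases hPQ with h | h
      exacts [⟨h.1.1, h.2.1⟩, ⟨h.1.1, h.2.1⟩]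
    exact ⟨⟨⟨hd.1, hPT⟩, ⟨hd.1, hPS⟩⟩, ⟨⟨hd.2, hQT⟩, ⟨hd.2, hQS⟩⟩⟩
  · rintro ⟨hP, hQ⟩
    obtain ⟨f, _⟩ := h.exists_iso_of_left_id hP
    exact f.isId hQ

/-- Gluing `A * B` has the same effect as gluing `B` and then `A`. -/
theorem sem_glue_iff {J : Ipomset α} {v : DWord α} {X : Tipomset α} {A B R : Step α}
    {i : A.pom.Ev → R.pom.Ev} {j : B.pom.Ev → R.pom.Ev} (h : IsGlue A.pom B.pom R.pom i j)
    (hAB : A.pom.IsStarter ∧ B.pom.IsStarter ∨ A.pom.IsTerminator ∧ B.pom.IsTerminator) :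
    Sem J (Sum.inl A :: Sum.inl B :: v) X ↔ Sem J (Sum.inl R :: v) X := by
  constructor
  · rintro (⟨hA, ⟨hB, hX⟩ | ⟨Z, a, b, hZ, hX⟩⟩ | ⟨Y, c, e, ⟨hB, hY⟩ | ⟨Z, a, b, hZ, hY⟩, hX⟩)
    · exact Or.inl ⟨(isId_glue_iff h hAB).2 ⟨hA, hB⟩, hX⟩
    · obtain ⟨f, _⟩ := h.exists_iso_of_left_id hA
      exact Or.inr ⟨Z, _, _, hZ, hX.of_iso f.symm (.refl _) (.refl _)⟩
    · obtain ⟨f, _⟩ := h.exists_iso_of_right_id hB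
      exact Or.inr ⟨Y, _, _, hY, hX.of_iso f.symm (.refl _) (.refl _)⟩
    · obtain ⟨k, hk⟩ := IsTGlue.assoc hY hX h
      exact Or.inr ⟨Z, _, _, hZ, hk⟩
  · rintro (⟨hR, hX⟩ | ⟨Z, k, l, hZ, hX⟩)
    · obtain ⟨hA, hB⟩ := (isId_glue_iff h hAB).1 hR
      exact Or.inl ⟨hA, Or.inl ⟨hB, hX⟩⟩
    -- `R` and `B` have the same target interface, so `Z` can be glued to `B`, and then `A` to the
    -- result. By associativity and uniqueness this is `X`.
    · have hBZ : B.pom.Composable Z.toIpomset := by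
        obtain ⟨m, -⟩ := hX.toIsGlue.exists_iface
        obtain ⟨e, he⟩ := exists_equiv_of_range_eq (f := fun t : B.pom.T => j t)
          (g := fun t : R.pom.T => (t : R.pom.Ev)) (h.inj_j.comp Subtype.val_injective)
          Subtype.val_injective (by
            ext y
            simp [h.T_eq])
        refine ⟨⟨e.trans m.e, fun t => ?_, fun t t' => ?_⟩⟩
        · rw [← h.lab_j, ← he t]
          exact m.lab_eq _
        · rw [← h.ev_j _ _ (B.pom.T_maximal _ t.2 _) (B.pom.T_maximal _ t'.2 _), ← he t, ← he t']
          exact m.ev_iff _ _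
      obtain ⟨Y, a, b, hY⟩ := exists_isTGlue B.isDiscrete hBZ
      obtain ⟨X', c, e, hX'⟩ := exists_isTGlue A.isDiscrete
        (hY.toIsGlue.composable_right h.composable)
      obtain ⟨k', hk'⟩ := IsTGlue.assoc hY hX' h
      obtain ⟨f⟩ := hk'.exists_iso hX
      exact Or.inr ⟨Y, _, _, Or.inr ⟨Z, a, b, hZ, hY⟩, hX'.of_iso (.refl _) (.refl _) f⟩

/-- Delays add because shifts compose, and rules on steps are `sem_glue_iff`. Inserting an identity
is sound in front of any `v` since `Sem` may skip it. -/
theorem Gen.sem_iff {a b : DWord α} (h : Gen a b) (J : Ipomset α) (v : DWord α) (X : Tipomset α) :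
    Sem J (a ++ v) X ↔ Sem J (b ++ v) X := by
  cases h with
  | delay d d' =>
    constructor
    · rintro ⟨Y, ⟨Z, hZ, ⟨s⟩⟩, ⟨t⟩⟩
      exact ⟨Z, hZ, ⟨add_comm d' d ▸ s.trans t⟩⟩
    · rintro ⟨Z, hZ, ⟨s⟩⟩
      -- The letter `d'` stands closer to the tail and acts first; the outcome agrees with `X` since
      -- a shift determines its result.
      have t := (Z.shiftShift d').trans ((Z.shift d').shiftShift d)
      rw [add_comm] at t
      have t' := ((Z.shift d').shiftShift d).trans (Shift.ofIso (t.isoRight s))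
      rw [add_zero] at t'
      exact ⟨_, ⟨Z, hZ, ⟨Z.shiftShift d'⟩⟩, ⟨t'⟩⟩
  | zero =>
    constructor
    · rintro ⟨Z, hZ, ⟨s⟩⟩
      exact hZ.of_iso (.refl _) s.iso
    · intro h
      exact ⟨X, h, ⟨Shift.ofIso (.refl X)⟩⟩
  | ident I hI =>
    constructor
    · rintro (⟨_, h⟩ | ⟨Z, i, j, hZ, hX⟩)
      · exact h
      · exact hZ.of_iso (.refl _) (hX.exists_iso_of_isId hI).some
    · exact fun h => Or.inl ⟨hI, h⟩
  | starters S₁ S₂ R h₁ h₂ m i =>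
    exact sem_glue_iff (m.isGlue.of_iso (.refl _) (.refl _) i.symm) (Or.inl ⟨h₁, h₂⟩)
  | terminators S₁ S₂ R h₁ h₂ m i =>
    exact sem_glue_iff (m.isGlue.of_iso (.refl _) (.refl _) i.symm) (Or.inr ⟨h₁, h₂⟩)
  | iso P Q f =>
    constructor
    · rintro (⟨hP, h⟩ | ⟨Z, i, j, hZ, hX⟩)
      · exact Or.inl ⟨f.isId hP, h⟩
      · exact Or.inr ⟨Z, _, _, hZ, hX.of_iso f.symm (.refl _) (.refl _)⟩
    · rintro (⟨hP, h⟩ | ⟨Z, i, j, hZ, hX⟩)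
      · exact Or.inl ⟨f.symm.isId hP, h⟩
      · exact Or.inr ⟨Z, _, _, hZ, hX.of_iso f (.refl _) (.refl _)⟩

theorem sem_append_iff {J : Ipomset α} {a b : DWord α} (h : ∀ X, Sem J a X ↔ Sem J b X)
    (u : DWord α) (X : Tipomset α) : Sem J (u ++ a) X ↔ Sem J (u ++ b) X := by
  induction u generalizing X with
  | nil => exact h X
  | cons l u ih => rcases l with P | d <;> simp only [List.cons_append, Sem, ih]

theorem Cong.sem_iff {w w' : DWord α} (h : Cong w w') (J : Ipomset α) (X : Tipomset α) :
    Sem J w X ↔ Sem J w' X := by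
  induction h with
  | rel _ _ h =>
    obtain ⟨u, a, b, v, h, _, _⟩ := h
    rw [List.append_assoc, List.append_assoc]
    exact sem_append_iff (h.sem_iff J v) u X
  | refl => rfl
  | symm _ _ _ ih => exact ih.symm
  | trans _ _ _ _ _ ih ih' => exact ih.trans ih'

/-! ### The meaning of a sparse word is its image under `tGlue` -/

theorem glueList_first_le {P : Ipomset α} {l : List (Ipomset α)}
    {h : List.IsChain Ipomset.Composable (P :: l)} {x : (glueList P l h).pom.Ev} {i : ℕ}
    (hi : x ∈ (glueList P l h).mem i) : (glueList P l h).first x ≤ i := Nat.sInf_le hi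

theorem glueList_le_last {P : Ipomset α} {l : List (Ipomset α)}
    {h : List.IsChain Ipomset.Composable (P :: l)} {x : (glueList P l h).pom.Ev} {i : ℕ}
    (hi : x ∈ (glueList P l h).mem i) : i ≤ (glueList P l h).last x :=
  le_csSup (glueList_bddAbove _ _ h x) hi

/-- The gluing of `P₀, …, Pₙ`, where time `ds i` passes between `Pᵢ` and `Pᵢ₊₁`. -/
noncomputable def timedGlue (P : Ipomset α) (l : List (Ipomset α))
    (h : List.IsChain Ipomset.Composable (P :: l)) (hd : ∀ Q ∈ P :: l, Q.IsDiscrete)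
    (ds : List ℝ≥0) (hl : ds.length ≤ l.length) : Tipomset α where
  toIpomset := (glueList P l h).pom
  lo x := (ds.take ((glueList P l h).first x)).sum
  hi x := (ds.take ((glueList P l h).last x)).sum
  dur := ds.sum
  lo_le_hi x := sum_take_mono _ (glueList_le_last (glueList_first_mem _ _ h x))
  hi_le_dur x := sum_take_le _ _
  lo_S x hx := by
    have : (glueList P l h).first x = 0 := Nat.le_zero.1 (glueList_first_le (glueList_S _ _ h x hx))
    simp [this]
  hi_T x hx := by
    rw [List.take_of_length_le (hl.trans (glueList_le_last (glueList_T _ _ h x hx)))]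
  lt_of_hi_lt_lo x y hxy := by
    refine (glueList_lt _ _ h hd x y).2 (fun i j hi hj => ?_)
    have h1 := glueList_le_last hi
    have h2 := glueList_first_le hj
    have h3 : (glueList P l h).last x < (glueList P l h).first y := by
      by_contra hc
      exact absurd hxy (not_lt.2 (sum_take_mono _ (not_lt.1 hc)))
    omega
  hi_le_lo_of_lt x y hxy := sum_take_mono _
    ((glueList_lt _ _ h hd x y).1 hxy _ _ (glueList_last_mem _ _ h x) (glueList_first_mem _ _ h y)).le

/-- A new factor in front raises the indices of the later factors by one, so that partial sums of
delays gain `d`. The exception is the start of an event in the source interface of the tail: it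
belongs to `P` too, its first index is `0`, and `shift` leaves its start at `0` accordingly. -/
theorem timedGlue_cons (P Q : Ipomset α) (l : List (Ipomset α))
    (h : List.IsChain Ipomset.Composable (P :: Q :: l)) (hd : ∀ R ∈ P :: Q :: l, R.IsDiscrete)
    (d : ℝ≥0) (ds : List ℝ≥0) (hl : ds.length ≤ l.length) :
    ∃ i j, IsTGlue P
      ((timedGlue Q l h.tail (fun R hR => hd R (List.mem_cons_of_mem _ hR)) ds hl).shift d)
      (timedGlue P (Q :: l) h hd (d :: ds) (Nat.succ_le_succ hl)) i j := by
  let G := glueList Q l h.tail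
  let m : P.Iface G.pom := Classical.choice (G.composable P (List.isChain_cons_cons.1 h).1)
  let H := glueList P (Q :: l) h
  let X := timedGlue P (Q :: l) h hd (d :: ds) (Nat.succ_le_succ hl)
  have g : IsGlue P G.pom H.pom m.inP m.inQ := m.isGlue
  have m0 : ∀ z : m.GEv, z ∈ H.mem 0 ↔ z ∈ Set.range m.inP := fun z => Iff.rfl
  have ms : ∀ (i : ℕ) (z : G.pom.Ev), m.inQ z ∈ H.mem (i + 1) ↔ z ∈ G.mem i :=
    fun i z => m.inQ_injective.mem_set_image
  have first_i : ∀ p, H.first (m.inP p) = 0 := fun p =>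
    Nat.le_zero.1 (glueList_first_le ((m0 _).2 ⟨p, rfl⟩))
  have last_i : ∀ p, p ∉ P.T → H.last (m.inP p) = 0 := fun p hp => by
    have hm := glueList_last_mem P (Q :: l) h (m.inP p)
    change m.inP p ∈ H.mem (H.last (m.inP p)) at hm
    cases hn : H.last (m.inP p) with
    | zero => rfl
    | succ n =>
      rw [hn] at hm
      obtain ⟨z, _, hz⟩ := hm
      exact (hp ((g.mem_T p).2 ⟨z, hz⟩)).elim
  have first_j : ∀ z, z ∉ G.pom.S → H.first (m.inQ z) = G.first z + 1 := fun z hz => by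
    refine le_antisymm (glueList_first_le ((ms _ _).2 (glueList_first_mem _ _ _ z))) ?_
    have hm := glueList_first_mem P (Q :: l) h (m.inQ z)
    change m.inQ z ∈ H.mem (H.first (m.inQ z)) at hm
    cases hn : H.first (m.inQ z) with
    | zero =>
      rw [hn] at hm
      exact (hz ((g.mem_S z).2 ((m0 _).1 hm))).elim
    | succ n =>
      rw [hn] at hm
      exact Nat.succ_le_succ (glueList_first_le ((ms _ _).1 hm))
  have last_j : ∀ z, H.last (m.inQ z) = G.last z + 1 := fun z => by
    refine le_antisymm ?_ (glueList_le_last ((ms _ _).2 (glueList_last_mem _ _ _ z)))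
    have hm := glueList_last_mem P (Q :: l) h (m.inQ z)
    change m.inQ z ∈ H.mem (H.last (m.inQ z)) at hm
    cases hn : H.last (m.inQ z) with
    | zero => exact Nat.zero_le _
    | succ n =>
      rw [hn] at hm
      exact Nat.succ_le_succ (glueList_le_last ((ms _ _).1 hm))
  have lo_i : ∀ p, X.lo (m.inP p) = 0 := fun p => by
    change ((d :: ds).take (H.first (m.inP p))).sum = 0
    rw [first_i]
    rfl
  refine ⟨m.inP, m.inQ, g, lo_i, fun p hp => ?_, fun z => ?_, fun z => ?_, ?_⟩
  · change ((d :: ds).take (H.last (m.inP p))).sum = 0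
    rw [last_i p hp]
    rfl
  · by_cases hz : z ∈ G.pom.S
    · obtain ⟨p, _, hp⟩ := g.exists_of_mem_S hz
      refine Eq.trans ?_ (if_pos hz).symm
      rw [← hp]
      exact lo_i p
    · refine Eq.trans ?_ (if_neg hz).symm
      change ((d :: ds).take (H.first (m.inQ z))).sum = (ds.take (G.first z)).sum + d
      rw [first_j z hz, List.take_succ_cons, List.sum_cons, add_comm]
  · change ((d :: ds).take (H.last (m.inQ z))).sum = (ds.take (G.last z)).sum + d
    rw [last_j z, List.take_succ_cons, List.sum_cons, add_comm]
  · change (d :: ds).sum = ds.sum + d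
    rw [List.sum_cons, add_comm]

/-- The word `d₀ P₁ d₁ … Pₙ dₙ`. -/
def innerWord (d₀ : ℝ≥0) (l : List (Step α × ℝ≥0)) : DWord α :=
  Sum.inr d₀ :: l.flatMap (fun s => [Sum.inl s.1, Sum.inr s.2])

/-- The first factor `P` is arbitrary rather than an identity, so that the induction can pass to the
tail. At its end only the factor `J` is left, with no delay after it. -/
theorem sem_timedGlue (J P : Ipomset α) (d₀ : ℝ≥0) (l : List (Step α × ℝ≥0))
    (h : List.IsChain Ipomset.Composable (P :: (l.map (fun s => s.1.pom) ++ [J])))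
    (hd : ∀ R ∈ P :: (l.map (fun s => s.1.pom) ++ [J]), R.IsDiscrete)
    (hl : (d₀ :: l.map Prod.snd).length ≤ (l.map (fun s => s.1.pom) ++ [J]).length) :
    ∃ Z i j, Sem J (innerWord d₀ l) Z ∧ IsTGlue P Z
      (timedGlue P (l.map (fun s => s.1.pom) ++ [J]) h hd (d₀ :: l.map Prod.snd) hl) i j := by
  induction l generalizing P d₀ with
  | nil =>
    obtain ⟨i, j, hg⟩ := timedGlue_cons P J [] h hd d₀ [] le_rfl
    exact ⟨_, i, j, ⟨_, ⟨⟨.refl _⟩, rfl⟩, ⟨Tipomset.shiftShift _ _⟩⟩, hg⟩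
  | cons s l ih =>
    have hl' : (s.2 :: l.map Prod.snd).length ≤ (l.map (fun s => s.1.pom) ++ [J]).length := by simp
    have hd' := fun R hR => hd R (List.mem_cons_of_mem _ hR)
    obtain ⟨i, j, hg⟩ := timedGlue_cons P s.1.pom _ h hd d₀ (s.2 :: l.map Prod.snd) hl'
    obtain ⟨Z, a, b, hZ, hg'⟩ := ih s.1.pom s.2 h.tail hd' hl'
    exact ⟨_, i, j, ⟨_, Or.inr ⟨Z, a, b, hZ, hg'⟩, ⟨Tipomset.shiftShift _ _⟩⟩, hg⟩

theorem SparseIdw.exists_isTGlue (w : SparseIdw α) :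
    ∃ Z i j, Sem w.J.pom w.inner Z ∧ IsTGlue w.I.pom Z w.tGlue i j :=
  sem_timedGlue w.J.pom w.I.pom w.d₀ w.steps w.coherent w.discrete (by simp)

theorem SparseIdw.sem_tGlue (w : SparseIdw α) : Sem w.J.pom w.inner w.tGlue := by
  obtain ⟨Z, i, j, hZ, hg⟩ := w.exists_isTGlue
  exact hZ.of_iso (.refl _) (hg.exists_iso_of_isId w.I.isId).some

/-- Well-definedness of the map on idwords: congruent inner words have the same meaning, and a
meaning is unique. -/
theorem SparseIdw.iso_of_toIDW_eq {w w' : SparseIdw α} (h : w.toIDW = w'.toIDW) :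
    Nonempty (w.tGlue.Iso w'.tGlue) := by
  obtain ⟨-, hc, ⟨f⟩⟩ := Quotient.exact h
  exact (((hc.sem_iff _ _).1 w.sem_tGlue).of_iso f.symm (.refl _)).iso w'.sem_tGlue

/-! ### Existence of sparse representatives -/

/-- The word `w` fits between `O` and `J`. -/
def Fits (O J : Ipomset α) (w : DWord α) : Prop :=
  List.IsChain Ipomset.Composable (O :: (w.steps ++ [J]))

/-- Congruence through words which fit between `O` and `J`. -/
def CongBetween (O J : Ipomset α) : DWord α → DWord α → Prop :=
  Relation.EqvGen fun w w' => (∃ u a b v, Gen a b ∧ w = u ++ a ++ v ∧ w' = u ++ b ++ v) ∧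
    Fits O J w ∧ Fits O J w'

theorem DWord.steps_append (u v : DWord α) : (u ++ v).steps = u.steps ++ v.steps :=
  List.filterMap_append

theorem DWord.steps_inl (P : Step α) (v : DWord α) :
    DWord.steps (Sum.inl P :: v) = P.pom :: v.steps := rfl

theorem Fits.coherent {O J : Ipomset α} {w : DWord α} (h : Fits O J w) : w.Coherent :=
  (List.isChain_append.1 h.tail).1

theorem fits_inr {O J : Ipomset α} {d : ℝ≥0} {w : DWord α} :
    Fits O J (Sum.inr d :: w) ↔ Fits O J w := Iff.rfl

theorem fits_inl {O J : Ipomset α} {P : Step α} {w : DWord α} :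
    Fits O J (Sum.inl P :: w) ↔ O.Composable P.pom ∧ Fits P.pom J w := List.isChain_cons_cons

theorem CongBetween.cong {O J : Ipomset α} {w w' : DWord α} (h : CongBetween O J w w') :
    Cong w w' := by
  induction h with
  | rel _ _ h =>
    obtain ⟨⟨u, a, b, v, h, rfl, rfl⟩, ha, hb⟩ := h
    exact .rel _ _ ⟨u, a, b, v, h, ha.coherent, hb.coherent⟩
  | refl => exact .refl _
  | symm _ _ _ ih => exact .symm _ _ ih
  | trans _ _ _ _ _ ih ih' => exact .trans _ _ _ ih ih'

/-- The reason for tracking neighbours: a derivation in `Cong` may pass through words which no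
longer fit after a letter added in front, whereas here all intermediate words keep fitting. -/
theorem CongBetween.cons {O O' J : Ipomset α} {w w' : DWord α} (h : CongBetween O J w w')
    (l : Step α ⊕ ℝ≥0) (hl : ∀ v, Fits O J v → Fits O' J (l :: v)) :
    CongBetween O' J (l :: w) (l :: w') := by
  induction h with
  | rel _ _ h =>
    obtain ⟨⟨u, a, b, v, h, rfl, rfl⟩, ha, hb⟩ := h
    exact .rel _ _ ⟨⟨l :: u, a, b, v, h, rfl, rfl⟩, hl _ ha, hl _ hb⟩
  | refl => exact .refl _
  | symm _ _ _ ih => exact .symm _ _ ih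
  | trans _ _ _ _ _ ih ih' => exact .trans _ _ _ ih ih'

theorem CongBetween.of_gen {O J : Ipomset α} {a b : DWord α} (h : Gen a b) (u v : DWord α)
    (ha : Fits O J (u ++ a ++ v)) (hb : Fits O J (u ++ b ++ v)) :
    CongBetween O J (u ++ a ++ v) (u ++ b ++ v) :=
  .rel _ _ ⟨⟨u, a, b, v, h, rfl, rfl⟩, ha, hb⟩

/-- `O` can be glued to `I * P`, which is isomorphic to `P`. Thus deleting an identity preserves
coherence. -/
theorem Ipomset.Composable.trans_id {O I P : Ipomset α} (h : O.Composable I) (hI : I.IsId)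
    (h' : I.Composable P) : O.Composable P := by
  obtain ⟨m⟩ := h'
  obtain ⟨f, _⟩ := m.isGlue.exists_iso_of_left_id hI
  obtain ⟨k⟩ := m.isGlue.composable_right h
  refine ⟨⟨k.e.trans (f.map.symm.subtypeEquiv fun x => ?_), fun x => ?_, fun x y => ?_⟩⟩
  · simpa using (f.map_S (f.map.symm x))
  · exact (k.lab_eq x).trans (f.symm.map_lab _).symm
  · exact (k.ev_iff x y).trans (f.symm.map_ev_of_S (k.e x).2 (k.e y).2)

theorem fits_of_head {O P J : Ipomset α} {w : DWord α} (h : Fits P J w)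
    (hO : ∀ Q, P.Composable Q → O.Composable Q) : Fits O J w := by
  unfold Fits at *
  cases hw : w.steps ++ [J] with
  | nil => simp at hw
  | cons Q l =>
    rw [hw, List.isChain_cons_cons] at h
    exact List.isChain_cons_cons.2 ⟨hO _ h.1, h.2⟩

/-- The sparsity condition on consecutive steps. -/
def Alternating (l : List (Step α × ℝ≥0)) : Prop :=
  l.IsChain (fun s s' => s.2 = 0 →
    (s.1.pom.IsStarterPlus ∧ s'.1.pom.IsTerminatorPlus) ∨
    (s.1.pom.IsTerminatorPlus ∧ s'.1.pom.IsStarterPlus))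

/-! ### Merging steps of the same kind -/

theorem IsGlue.isStarter {P Q Y : Ipomset α} {i : P.Ev → Y.Ev} {j : Q.Ev → Y.Ev}
    (h : IsGlue P Q Y i j) (hP : P.IsStarter) (hQ : Q.IsStarter) : Y.IsStarter := by
  have hj : ∀ y, ∃ q, j q = y := fun y => by
    rcases h.cases_j y with ⟨p, hp, _⟩ | k
    · exact (hp (hP.2 ▸ Set.mem_univ p)).elim
    · exact k
  constructor
  · intro x y hxy
    obtain ⟨q, rfl⟩ := hj x
    obtain ⟨q', rfl⟩ := hj y
    exact hQ.1 _ _ ((h.lt_j _ _).1 hxy)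
  · refine Set.eq_univ_of_forall fun y => ?_
    obtain ⟨q, rfl⟩ := hj y
    rw [h.mem_T_j, hQ.2]
    trivial

theorem IsGlue.isTerminator {P Q Y : Ipomset α} {i : P.Ev → Y.Ev} {j : Q.Ev → Y.Ev}
    (h : IsGlue P Q Y i j) (hP : P.IsTerminator) (hQ : Q.IsTerminator) : Y.IsTerminator := by
  have hi : ∀ y, ∃ p, i p = y := fun y => by
    rcases h.cases_i y with k | ⟨q, hq, _⟩
    · exact k
    · exact (hq (hQ.2 ▸ Set.mem_univ q)).elim
  constructor
  · intro x y hxy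
    obtain ⟨q, rfl⟩ := hi x
    obtain ⟨q', rfl⟩ := hi y
    exact hP.1 _ _ ((h.lt_i _ _).1 hxy)
  · refine Set.eq_univ_of_forall fun y => ?_
    obtain ⟨q, rfl⟩ := hi y
    rw [h.mem_S_i, hP.2]
    trivial

/-- Two consecutive steps of the same kind can be merged. -/
theorem exists_merge {P Q : Step α} (h : P.pom.Composable Q.pom) (hP : ¬ P.pom.IsId)
    (hPQ : P.pom.IsStarter ∧ Q.pom.IsStarter ∨ P.pom.IsTerminator ∧ Q.pom.IsTerminator) :
    ∃ (R : Step α) (i : _) (j : _), Gen [Sum.inl P, Sum.inl Q] [Sum.inl R] ∧ ¬ R.pom.IsId ∧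
      (P.pom.IsStarter ∧ R.pom.IsStarter ∨ P.pom.IsTerminator ∧ R.pom.IsTerminator) ∧
      IsGlue P.pom Q.pom R.pom i j := by
  obtain ⟨m⟩ := h
  have g := m.isGlue
  have hR : ¬ (P.pom.glue Q.pom m).IsId := fun h => hP ((isId_glue_iff g hPQ).1 h).1
  rcases hPQ with ⟨h1, h2⟩ | ⟨h1, h2⟩
  · have hs := g.isStarter h1 h2
    exact ⟨⟨_, Or.inl hs⟩, _, _, .starters P Q _ h1 h2 m (.refl _), hR, Or.inl ⟨h1, hs⟩, g⟩
  · have hs := g.isTerminator h1 h2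
    exact ⟨⟨_, Or.inr hs⟩, _, _, .terminators P Q _ h1 h2 m (.refl _), hR, Or.inr ⟨h1, hs⟩, g⟩

/-- A step in front of a sparse word can be merged into it. -/
theorem exists_alternating_cons {O J : Ipomset α} (P : Step α) (hP : ¬ P.pom.IsId) (d₀ : ℝ≥0)
    (l : List (Step α × ℝ≥0)) (hl : ∀ s ∈ l, ¬ s.1.pom.IsId) (ha : Alternating l)
    (hf : Fits O J (Sum.inl P :: innerWord d₀ l)) :
    ∃ l', (∀ s ∈ l', ¬ s.1.pom.IsId) ∧ Alternating l' ∧ Fits O J (innerWord 0 l') ∧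
      CongBetween O J (Sum.inl P :: innerWord d₀ l) (innerWord 0 l') := by
  -- If `P` can stay in front as it is, only the initial delay `0` has to be inserted.
  by_cases hc : Alternating ((P, d₀) :: l)
  · exact ⟨(P, d₀) :: l, by simpa [hP] using hl, hc, hf,
      .symm _ _ (CongBetween.of_gen .zero [] (Sum.inl P :: innerWord d₀ l) hf hf)⟩
  cases l with
  | nil => exact (hc (List.isChain_singleton _)).elim
  | cons s l =>
    obtain ⟨Q, d₁⟩ := s
    have hQ : ¬ Q.pom.IsId := hl (Q, d₁) (by simp)
    -- As `l` itself is sparse, the condition fails between `P` and `Q`: no time passes and both are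
    -- of the same kind.
    have hd : d₀ = 0 := by
      by_contra hd
      exact hc (List.isChain_cons_cons.2 ⟨fun h => (hd h).elim, ha⟩)
    have hn : ¬ ((P.pom.IsStarterPlus ∧ Q.pom.IsTerminatorPlus) ∨
        (P.pom.IsTerminatorPlus ∧ Q.pom.IsStarterPlus)) := fun h =>
      hc (List.isChain_cons_cons.2 ⟨fun _ => h, ha⟩)
    have hPQ : P.pom.IsStarter ∧ Q.pom.IsStarter ∨ P.pom.IsTerminator ∧ Q.pom.IsTerminator := by
      rcases P.starter_or_terminator with h1 | h1 <;> rcases Q.starter_or_terminator with h2 | h2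
      · exact Or.inl ⟨h1, h2⟩
      · exact (hn (Or.inl ⟨⟨h1, hP⟩, ⟨h2, hQ⟩⟩)).elim
      · exact (hn (Or.inr ⟨⟨h1, hP⟩, ⟨h2, hQ⟩⟩)).elim
      · exact Or.inr ⟨h1, h2⟩
    subst hd
    have hf1 : Fits O J (Sum.inl P :: Sum.inl Q :: innerWord d₁ l) := hf
    obtain ⟨h1, hf2⟩ := fits_inl.1 hf1
    obtain ⟨h2, hf3⟩ := fits_inl.1 hf2
    obtain ⟨R, i, j, hgen, hR, hPR, g⟩ := exists_merge h2 hP hPQ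
    have hf4 : Fits O J (Sum.inl R :: innerWord d₁ l) := fits_inl.2
      ⟨g.composable_right h1, fits_of_head hf3 fun _ => g.composable_left⟩
    refine ⟨(R, d₁) :: l, ?_, ?_, hf4, ?_⟩
    · intro s hs
      rcases List.mem_cons.1 hs with rfl | hs
      · exact hR
      · exact hl s (List.mem_cons_of_mem _ hs)
    · cases l with
      | nil => exact List.isChain_singleton _
      | cons t l =>
        obtain ⟨k1, k2⟩ := List.isChain_cons_cons.1 ha
        refine List.isChain_cons_cons.2 ⟨fun hd => ?_, k2⟩
        -- `R` is of the same kind as `Q`, so it inherits the condition towards the next step `t`.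
        -- In the mixed cases `P` would be an identity.
        rcases hPQ with ⟨p1, p2⟩ | ⟨p1, p2⟩ <;> rcases hPR with ⟨r1, r2⟩ | ⟨r1, r2⟩
        · rcases k1 hd with ⟨_, k⟩ | ⟨k, _⟩
          · exact Or.inl ⟨⟨r2, hR⟩, k⟩
          · exact (hQ ⟨p2, k.1⟩).elim
        · exact (hP ⟨p1, r1⟩).elim
        · exact (hP ⟨r1, p1⟩).elim
        · rcases k1 hd with ⟨k, _⟩ | ⟨_, k⟩
          · exact (hQ ⟨k.1, p2⟩).elim
          · exact Or.inr ⟨⟨r2, hR⟩, k⟩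
    -- Delete the delay `0` between the steps, merge them, and insert a delay `0` in front.
    · have c1 : CongBetween O J _ _ :=
        CongBetween.of_gen .zero [Sum.inl P] (Sum.inl Q :: innerWord d₁ l) hf hf1
      have c2 : CongBetween O J _ _ := CongBetween.of_gen hgen [] (innerWord d₁ l) hf1 hf4
      have c3 : CongBetween O J _ _ :=
        CongBetween.of_gen .zero [] (Sum.inl R :: innerWord d₁ l) hf4 hf4
      exact (c1.trans _ _ _ c2).trans _ _ _ (c3.symm _ _)

/-- Every word is congruent to a sparse one. -/
theorem exists_sparse {O J : Ipomset α} {w : DWord α} (hf : Fits O J w) :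
    ∃ d₀ l, (∀ s ∈ l, ¬ s.1.pom.IsId) ∧ Alternating l ∧ Fits O J (innerWord d₀ l) ∧
      CongBetween O J w (innerWord d₀ l) := by
  induction w generalizing O with
  | nil => exact ⟨0, [], by simp, List.isChain_nil, hf,
      .symm _ _ (CongBetween.of_gen .zero [] [] hf hf)⟩
  | cons a w ih =>
    rcases a with P | d
    · obtain ⟨hO, hf'⟩ := fits_inl.1 hf
      obtain ⟨d₀, l, hl, ha, hl', hc⟩ := ih hf'
      have hc' : CongBetween O J _ _ := hc.cons (Sum.inl P) fun v hv => fits_inl.2 ⟨hO, hv⟩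
      by_cases hP : P.pom.IsId
      · have hf2 : Fits O J (innerWord d₀ l) := fits_of_head hl' fun _ => hO.trans_id hP
        exact ⟨d₀, l, hl, ha, hf2, hc'.trans _ _ _
          (CongBetween.of_gen (.ident P hP) [] (innerWord d₀ l) (fits_inl.2 ⟨hO, hl'⟩) hf2)⟩
      · obtain ⟨l', k1, k2, k3, k4⟩ :=
          exists_alternating_cons P hP d₀ l hl ha (fits_inl.2 ⟨hO, hl'⟩)
        exact ⟨0, l', k1, k2, k3, hc'.trans _ _ _ k4⟩
    · obtain ⟨d₀, l, hl, ha, hl', hc⟩ := ih (fits_inr.1 hf)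
      have hc' : CongBetween O J _ _ := hc.cons (Sum.inr d) fun v hv => hv
      exact ⟨d + d₀, l, hl, ha, hl', hc'.trans _ _ _
        (CongBetween.of_gen (.delay d d₀) [] (l.flatMap _) hl' hl')⟩

theorem fits_innerWord {O J : Ipomset α} {d₀ : ℝ≥0} {l : List (Step α × ℝ≥0)} :
    Fits O J (innerWord d₀ l) ↔
      List.IsChain Ipomset.Composable (O :: (l.map (fun s => s.1.pom) ++ [J])) := by
  have h : DWord.steps (innerWord d₀ l) = l.map (fun s => s.1.pom) := by
    induction l generalizing d₀ with
    | nil => rfl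
    | cons s l ih => exact congrArg (s.1.pom :: ·) (@ih s.2)
  rw [Fits, h]

theorem exists_toIDW_eq (x : IDW α) : ∃ w : SparseIdw α, w.toIDW = x := by
  obtain ⟨r, rfl⟩ := Quotient.exists_rep x
  have hf : Fits r.I.pom r.J.pom r.w := by
    have h := r.coherent
    rw [DWord.Coherent, List.cons_append, DWord.steps_inl, DWord.steps_append] at h
    exact h
  obtain ⟨d₀, l, hl, ha, hl', hc⟩ := exists_sparse hf
  exact ⟨⟨r.I, d₀, l, r.J, fits_innerWord.1 hl', hl, ha⟩,
    Quotient.sound ⟨⟨.refl _⟩, hc.cong.symm, ⟨.refl _⟩⟩⟩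

/-! ### Isomorphic sparse words represent the same idword -/

theorem Ipomset.Composable.iso_right {O P P' : Ipomset α} (h : O.Composable P) (f : P.Iso P') :
    O.Composable P' := by
  obtain ⟨k⟩ := h
  refine ⟨⟨k.e.trans (f.map.subtypeEquiv fun x => (f.map_S x).symm), fun x => ?_, fun x y => ?_⟩⟩
  · exact (k.lab_eq x).trans (f.map_lab _).symm
  · exact (k.ev_iff x y).trans (f.map_ev_of_S (k.e x).2 (k.e y).2)

theorem Ipomset.Composable.iso_left {O P P' : Ipomset α} (h : P.Composable O) (f : P'.Iso P) :
    P'.Composable O := by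
  obtain ⟨k⟩ := h
  refine ⟨⟨(f.map.subtypeEquiv fun x => (f.map_T x).symm).trans k.e, fun x => ?_, fun x y => ?_⟩⟩
  · exact (f.map_lab _).symm.trans (k.lab_eq ⟨f.map x, (f.map_T _).2 x.2⟩)
  · exact (f.map_ev_of_T x.2 y.2).trans
      (k.ev_iff ⟨f.map x, (f.map_T _).2 x.2⟩ ⟨f.map y, (f.map_T _).2 y.2⟩)

theorem CongBetween.fits_iff {O J : Ipomset α} {w w' : DWord α} (h : CongBetween O J w w') :
    Fits O J w ↔ Fits O J w' := by
  induction h with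
  | rel _ _ h => exact iff_of_true h.2.1 h.2.2
  | refl => rfl
  | symm _ _ _ ih => exact ih.symm
  | trans _ _ _ _ _ ih ih' => exact ih.trans ih'

/-- Steps are exchanged one at a time by `Gen.iso`, the tail before the head; each intermediate word
fits because composability is invariant under isomorphism. -/
theorem congBetween_of_iso {O J : Ipomset α} {d : ℝ≥0} {l l' : List (Step α × ℝ≥0)}
    (h : List.Forall₂ (fun s s' => Nonempty (s.1.pom.Iso s'.1.pom) ∧ s.2 = s'.2) l l')
    (hf : Fits O J (innerWord d l)) : CongBetween O J (innerWord d l) (innerWord d l') := by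
  induction h generalizing O d with
  | nil => exact .refl _
  | @cons s s' l l' hs _ ih =>
    obtain ⟨s, d₁⟩ := s
    obtain ⟨s', d₂⟩ := s'
    obtain ⟨⟨f⟩, rfl : d₁ = d₂⟩ := hs
    obtain ⟨hO, hf'⟩ := fits_inl.1 (fits_inr.1 hf)
    have c := ih hf'
    have c1 : CongBetween O J _ _ := (c.cons (Sum.inl s) (fun v hv =>
      fits_inl.2 ⟨hO, hv⟩)).cons (Sum.inr d) (fun v hv => fits_inr.2 hv)
    have c2 : CongBetween O J _ _ := CongBetween.of_gen (.iso s s' f) [Sum.inr d]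
      (innerWord d₁ l') (c1.fits_iff.1 hf) (fits_inr.2 (fits_inl.2 ⟨hO.iso_right f,
        fits_of_head (c.fits_iff.1 hf') fun _ hQ => hQ.iso_left f.symm⟩))
    exact c1.trans _ _ _ c2

theorem SparseIdw.Same.toIDW_eq {w w' : SparseIdw α} (h : w.Same w') : w.toIDW = w'.toIDW := by
  obtain ⟨hI, hd, hl, hJ⟩ := h
  refine Quotient.sound ⟨hI, ?_, hJ⟩
  have c := congBetween_of_iso (d := w.d₀) hl (fits_innerWord.2 w.coherent)
  have : innerWord w.d₀ w'.steps = w'.inner := by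
    rw [hd]
    rfl
  have c' : Cong w.inner (innerWord w.d₀ w'.steps) := c.cong
  rwa [this] at c'

/-! ### The factors of a gluing -/

/-- Orders, labels and sources of the first factor are inherited from `Y`. Only its set of events
and its target interface have to be known. -/
theorem IsGlue.iso_left {P Q P' Q' Y : Ipomset α} {i : P.Ev → Y.Ev} {j : Q.Ev → Y.Ev}
    {i' : P'.Ev → Y.Ev} {j' : Q'.Ev → Y.Ev} (g : IsGlue P Q Y i j) (g' : IsGlue P' Q' Y i' j')
    (hr : Set.range i = Set.range i') (hT : ∀ p p', i p = i' p' → (p ∈ P.T ↔ p' ∈ P'.T)) :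
    Nonempty (P.Iso P') := by
  obtain ⟨e, he⟩ := exists_equiv_of_range_eq g.inj_i g'.inj_i hr
  refine ⟨⟨e, fun x => ?_, fun x => ?_, fun x => ?_, fun x y => ?_, fun x y h1 h2 => ?_⟩⟩
  · rw [← g'.mem_S_i, he, g.mem_S_i]
  · exact (hT _ _ (he x).symm).symm
  · rw [← g'.lab_i, he, g.lab_i]
  · rw [← g'.lt_i, he, he, g.lt_i]
  · have hlt : ∀ x y, P'.lt (e x) (e y) ↔ P.lt x y := fun x y => by
      rw [← g'.lt_i, he, he, g.lt_i]
    rw [← g.ev_i _ _ h1 h2, ← g'.ev_i _ _ (by rwa [hlt]) (by rwa [hlt]), he, he]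

theorem IsGlue.mem_range_j_iff {P Q Y : Ipomset α} {i : P.Ev → Y.Ev} {j : Q.Ev → Y.Ev}
    (g : IsGlue P Q Y i j) (y : Y.Ev) : y ∈ Set.range j ↔ ∀ p, i p = y → p ∈ P.T := by
  constructor
  · rintro h p rfl
    exact (g.mem_T p).2 h
  · intro h
    rcases g.cases_j y with ⟨p, hp, e⟩ | k
    · exact (hp (h p e)).elim
    · exact k

/-- The first factor also determines the remainder, whose events are all those of `Y` except the
events of `P` outside `P.T`. -/
theorem IsTGlue.iso_right {P P' : Ipomset α} {Z Z' Y : Tipomset α} {i : P.Ev → Y.Ev}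
    {j : Z.Ev → Y.Ev} {i' : P'.Ev → Y.Ev} {j' : Z'.Ev → Y.Ev} (g : IsTGlue P Z Y i j)
    (g' : IsTGlue P' Z' Y i' j') (hr : Set.range i = Set.range i')
    (hT : ∀ p p', i p = i' p' → (p ∈ P.T ↔ p' ∈ P'.T)) : Nonempty (Z.Iso Z') := by
  obtain ⟨e, he⟩ := exists_equiv_of_range_eq g.inj_j g'.inj_j (by
    ext y
    rw [g.mem_range_j_iff, g'.mem_range_j_iff]
    constructor
    · rintro h p' rfl
      obtain ⟨p, hp⟩ : i' p' ∈ Set.range i := hr ▸ ⟨p', rfl⟩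
      exact (hT p p' hp).1 (h p hp)
    · rintro h p rfl
      obtain ⟨p', hp⟩ : i p ∈ Set.range i' := hr ▸ ⟨p, rfl⟩
      exact (hT p p' hp.symm).2 (h p' hp))
  have hlt : ∀ x y, Z'.lt (e x) (e y) ↔ Z.lt x y := fun x y => by
    rw [← g'.lt_j, he, he, g.lt_j]
  refine ⟨Tipomset.isoOfIso ⟨e, fun x => ?_, fun x => ?_, fun x => ?_, hlt,
    fun x y h1 h2 => ?_⟩ (fun x _ => ?_) (fun x => ?_) ?_⟩
  · rw [g'.mem_S, he, g.mem_S, hr]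
  · rw [← g'.mem_T_j, he, g.mem_T_j]
  · rw [← g'.lab_j, he, g.lab_j]
  · rw [← g.ev_j _ _ h1 h2, ← g'.ev_j _ _ (by rwa [hlt]) (by rwa [hlt]), he, he]
  · rw [← g'.lo_j, he, g.lo_j]
  · rw [← g'.hi_j, he, g.hi_j]
  · rw [← g'.dur_eq, g.dur_eq]

/-! ### The first step of a sparse word -/

/-- Events start at time `0`, and nothing has to end before. -/
def Tipomset.Starts (Y : Tipomset α) (y : Y.Ev) : Prop :=
  y ∉ Y.S ∧ Y.lo y = 0 ∧ ∀ x, ¬ Y.lt x y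

/-- Events end at time `0`, before anything starts. -/
def Tipomset.Ends (Y : Tipomset α) (x : Y.Ev) : Prop :=
  x ∈ Y.S ∧ x ∉ Y.T ∧ Y.hi x = 0 ∧ ∀ y, y ∉ Y.S → Y.lt x y

/-- Decides the kind of the first step: a proper starter yields an event which starts, a proper
terminator one which ends. -/
theorem Tipomset.Starts.not_ends {Y : Tipomset α} {y x : Y.Ev} (h : Y.Starts y) : ¬ Y.Ends x :=
  fun h' => h.2.2 x (h'.2.2.2 y h.1)

namespace IsTGlue

variable {P : Ipomset α} {Z Y : Tipomset α} {i : P.Ev → Y.Ev} {j : Z.Ev → Y.Ev}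

theorem starts_i (g : IsTGlue P Z Y i j) (hP : P.IsDiscrete) {p : P.Ev} (hp : p ∉ P.S) :
    Y.Starts (i p) := by
  refine ⟨fun h => hp ((g.mem_S_i p).1 h), g.lo_i p, fun x hx => ?_⟩
  rcases g.cases_i x with ⟨p', rfl⟩ | ⟨q, hq, rfl⟩
  · exact hP _ _ ((g.lt_i _ _).1 hx)
  · exact g.not_lt_ji hq hx

theorem range_i_of_isTerminator (g : IsTGlue P Z Y i j) (hP : P.IsTerminator) :
    Set.range i = Y.S := by
  rw [g.S_eq, hP.2, Set.image_univ]

theorem ends_i (g : IsTGlue P Z Y i j) (hP : P.IsTerminator) {p : P.Ev} (hp : p ∉ P.T) :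
    Y.Ends (i p) := by
  refine ⟨g.range_i_of_isTerminator hP ▸ ⟨p, rfl⟩, g.not_mem_T_i hp, g.hi_i p hp, fun y hy => ?_⟩
  rw [← g.range_i_of_isTerminator hP] at hy
  rcases g.cases_i y with k | ⟨q, hq, rfl⟩
  · exact (hy k).elim
  · exact g.lt_ij p q hp hq

theorem exists_starts (g : IsTGlue P Z Y i j) (hP : P.IsStarterPlus) : ∃ y, Y.Starts y := by
  by_contra! h
  refine hP.2 ⟨hP.1, hP.1.1, Set.eq_univ_of_forall fun p => ?_⟩
  by_contra hp
  exact h _ (g.starts_i hP.1.1 hp)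

theorem exists_ends (g : IsTGlue P Z Y i j) (hP : P.IsTerminatorPlus) : ∃ y, Y.Ends y := by
  by_contra! h
  refine hP.2 ⟨⟨hP.1.1, Set.eq_univ_of_forall fun p => ?_⟩, hP.1⟩
  by_contra hp
  exact h _ (g.ends_i hP.1 hp)

/-- Recovers a first starter from `Y`. An event outside `P` which starts in `Y` would also start in
`Z`, and sparsity excludes this through `hZ`. -/
theorem mem_range_i_iff (g : IsTGlue P Z Y i j) (hP : P.IsDiscrete) (hZ : ∀ z, ¬ Z.Starts z)
    (y : Y.Ev) : y ∈ Set.range i ↔ y ∈ Y.S ∨ Y.Starts y := by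
  constructor
  · rintro ⟨p, rfl⟩
    by_cases hp : p ∈ P.S
    · exact Or.inl ((g.mem_S_i p).2 hp)
    · exact Or.inr (g.starts_i hP hp)
  · intro h
    rcases g.cases_i y with k | ⟨z, hz, rfl⟩
    · exact k
    · rcases h with h | h
      · exact (g.not_mem_S_j hz h).elim
      · refine (hZ z ⟨hz, ?_, fun x hx => ?_⟩).elim
        · rw [← g.lo_j, h.2.1]
        · exact h.2.2 _ ((g.lt_j _ _).2 hx)

/-- Recovers a first terminator: an event which ends in `Y` but goes on after `P` would still end in
`Z`. -/
theorem not_mem_T_iff (g : IsTGlue P Z Y i j) (hP : P.IsTerminator) (hZ : ∀ z, ¬ Z.Ends z)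
    (p : P.Ev) : p ∉ P.T ↔ Y.Ends (i p) := by
  refine ⟨g.ends_i hP, fun h hp => ?_⟩
  obtain ⟨z, hz, e⟩ := g.exists_of_mem_T hp
  rw [← e] at h
  refine hZ z ⟨hz, fun hT => h.2.1 ((g.mem_T_j z).2 hT), by rw [← g.hi_j, h.2.2.1], fun y hy => ?_⟩
  rw [← g.lt_j]
  exact h.2.2.2 _ (g.not_mem_S_j hy)

end IsTGlue

/-- The word `P₁ d₁ … Pₙ dₙ`. -/
abbrev stepsWord (l : List (Step α × ℝ≥0)) : DWord α :=
  l.flatMap (fun s => [Sum.inl s.1, Sum.inr s.2])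

theorem Sem.nil_mem {J : Ipomset α} (hJ : J.IsId) {Y : Tipomset α} (h : Sem J [] Y) (y : Y.Ev) :
    y ∈ Y.S ∧ y ∈ Y.T := by
  obtain ⟨⟨f⟩, _⟩ := h
  have := f.isId hJ
  exact ⟨this.2.2 ▸ Set.mem_univ y, this.1.2 ▸ Set.mem_univ y⟩

theorem Sem.exists_of_inl {J : Ipomset α} {P : Step α} {w : DWord α} {X : Tipomset α}
    (h : Sem J (Sum.inl P :: w) X) (hP : ¬ P.pom.IsId) :
    ∃ (Z : Tipomset α) (i : _) (j : _), Sem J w Z ∧ IsTGlue P.pom Z X i j :=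
  h.resolve_left fun k => hP k.1

theorem Step.starterPlus_or_terminatorPlus (P : Step α) (hP : ¬ P.pom.IsId) :
    P.pom.IsStarterPlus ∨ P.pom.IsTerminatorPlus :=
  P.starter_or_terminator.imp (fun h => ⟨h, hP⟩) (fun h => ⟨h, hP⟩)

/-- The tail of a sparse word neither starts events immediately after a starter nor ends events
immediately after a terminator. -/
theorem Sem.not_starts_not_ends {J : Ipomset α} (hJ : J.IsId) {s : Step α × ℝ≥0}
    {l : List (Step α × ℝ≥0)} (hs : ¬ s.1.pom.IsId) (hl : ∀ s ∈ l, ¬ s.1.pom.IsId)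
    (ha : Alternating (s :: l)) {Z : Tipomset α} (h : Sem J (innerWord s.2 l) Z) :
    (s.1.pom.IsStarter → ∀ z, ¬ Z.Starts z) ∧ (s.1.pom.IsTerminator → ∀ z, ¬ Z.Ends z) := by
  obtain ⟨Y, hY, ⟨t⟩⟩ := h
  -- Without delay, the next step is of the opposite kind or only `J` is left. A positive delay
  -- moves all ends and all new starts away from `0`.
  by_cases hd : s.2 = 0
  · rw [hd] at t
    replace hY : Sem J (stepsWord l) Z := hY.of_iso (.refl _) t.iso
    cases l with
    | nil =>
      have := hY.nil_mem hJ
      exact ⟨fun _ z hz => hz.1 (this z).1, fun _ z hz => hz.2.1 (this z).2⟩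
    | cons s' l =>
      obtain ⟨Z', i, j, _, g⟩ := Sem.exists_of_inl hY (hl s' (by simp))
      rcases (List.isChain_cons_cons.1 ha).1 hd with ⟨h1, h2⟩ | ⟨h1, h2⟩
      · obtain ⟨x, hx⟩ := g.exists_ends h2
        exact ⟨fun _ z hz => hz.not_ends hx, fun h => (hs ⟨h1.1, h⟩).elim⟩
      · obtain ⟨x, hx⟩ := g.exists_starts h2
        exact ⟨fun h => (hs ⟨h, h1.1⟩).elim, fun _ z => hx.not_ends⟩
  · refine ⟨fun _ z hz => ?_, fun _ z hz => ?_⟩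
    · obtain ⟨y, rfl⟩ := t.map.surjective z
      have h1 := hz.2.1
      rw [t.map_lo y (fun c => hz.1 ((t.map_S y).2 c))] at h1
      exact hd (add_eq_zero.1 h1).2
    · obtain ⟨y, rfl⟩ := t.map.surjective z
      have h1 := hz.2.2.1
      rw [t.map_hi y] at h1
      exact hd (add_eq_zero.1 h1).2

/-- Something happens at time `0`. -/
def Tipomset.Active (Y : Tipomset α) : Prop :=
  ∃ y, (y ∉ Y.S ∧ Y.lo y = 0) ∨ (y ∉ Y.T ∧ Y.hi y = 0)

theorem Sem.active {J : Ipomset α} {s : Step α × ℝ≥0} {l : List (Step α × ℝ≥0)}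
    (hs : ¬ s.1.pom.IsId) {Y : Tipomset α} (h : Sem J (stepsWord (s :: l)) Y) : Y.Active := by
  obtain ⟨Z, i, j, _, g⟩ := Sem.exists_of_inl h hs
  rcases s.1.starterPlus_or_terminatorPlus hs with h | h
  · obtain ⟨y, hy⟩ := g.exists_starts h
    exact ⟨y, Or.inl ⟨hy.1, hy.2.1⟩⟩
  · obtain ⟨y, hy⟩ := g.exists_ends h
    exact ⟨y, Or.inr ⟨hy.2.1, hy.2.2.1⟩⟩

/-- Something in `X` happens at time `d`, and nothing can happen before `d'`. Applied in both
directions, it shows that `X` determines the first delay of a sparse word with at least one step. -/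
theorem Tipomset.Active.le {Y Y' X : Tipomset α} (h : Y.Active) {d d' : ℝ≥0} (s : Shift d Y X)
    (s' : Shift d' Y' X) : d' ≤ d := by
  obtain ⟨y, ⟨hy, h0⟩ | ⟨hy, h0⟩⟩ := h
  · have h1 := s.map_lo y hy
    obtain ⟨y', e⟩ := s'.map.surjective (s.map y)
    rw [← e, s'.map_lo y' (fun c => hy ((s.map_S y).1 (e ▸ (s'.map_S y').2 c))), h0, zero_add] at h1
    exact h1 ▸ le_add_self
  · have h1 := s.map_hi y
    obtain ⟨y', e⟩ := s'.map.surjective (s.map y)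
    rw [← e, s'.map_hi y', h0, zero_add] at h1
    exact h1 ▸ le_add_self

/-- In a shift of an active timed ipomset, not all events are in both interfaces. -/
theorem Tipomset.Active.not_forall {Y Y' X : Tipomset α} (h : Y.Active) {d d' : ℝ≥0}
    (s : Shift d Y X) (s' : Shift d' Y' X) : ¬ ∀ y, y ∈ Y'.S ∧ y ∈ Y'.T := by
  intro h'
  obtain ⟨y, h⟩ := h
  obtain ⟨y', e⟩ := s'.map.surjective (s.map y)
  have hS : y ∈ Y.S := (s.map_S y).1 (e ▸ (s'.map_S y').2 (h' y').1)
  have hT : y ∈ Y.T := (s.map_T y).1 (e ▸ (s'.map_T y').2 (h' y').2)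
  rcases h with h | h
  exacts [h.1 hS, h.1 hT]

/-- A timed ipomset determines its sparse word. -/
theorem sparse_unique {J J' : Ipomset α} (hJ : J.IsId) (hJ' : J'.IsId) {d d' : ℝ≥0}
    {l l' : List (Step α × ℝ≥0)} (hl : ∀ s ∈ l, ¬ s.1.pom.IsId) (hl' : ∀ s ∈ l', ¬ s.1.pom.IsId)
    (ha : Alternating l) (ha' : Alternating l') {X : Tipomset α} (h : Sem J (innerWord d l) X)
    (h' : Sem J' (innerWord d' l') X) :
    d = d' ∧ List.Forall₂ (fun s s' => Nonempty (s.1.pom.Iso s'.1.pom) ∧ s.2 = s'.2) l l' ∧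
      Nonempty (J.Iso J') := by
  induction l generalizing d d' l' X with
  | nil =>
    obtain ⟨Y, hY, ⟨s⟩⟩ := h
    obtain ⟨Y', hY', ⟨s'⟩⟩ := h'
    cases l' with
    | nil =>
      have hd : d = d' := by
        have h1 := s.dur_eq
        rwa [s'.dur_eq, hY.2, hY'.2, zero_add, zero_add, eq_comm] at h1
      subst hd
      obtain ⟨⟨f⟩, _⟩ := hY
      obtain ⟨⟨f'⟩, _⟩ := hY'
      exact ⟨rfl, .nil, ⟨(f.trans (s.isoLeft s').toIso).trans f'.symm⟩⟩
    | cons t' l' => exact ((Sem.active (hl' t' (by simp)) hY').not_forall s' s (hY.nil_mem hJ)).elim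
  | cons t l ih =>
    obtain ⟨Y, hY, ⟨s⟩⟩ := h
    obtain ⟨Y', hY', ⟨s'⟩⟩ := h'
    have htn := hl t (by simp)
    cases l' with
    | nil => exact ((Sem.active htn hY).not_forall s s' (hY'.nil_mem hJ')).elim
    | cons t' l' =>
      have htn' := hl' t' (by simp)
      have hd : d = d' :=
        le_antisymm ((Sem.active htn' hY').le s' s) ((Sem.active htn hY).le s s')
      subst hd
      -- Cancelling the common delay lets both words describe the same `Y`, in which their first
      -- steps can be compared.
      replace hY' : Sem J' (stepsWord (t' :: l')) Y := hY'.of_iso (.refl _) (s'.isoLeft s)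
      obtain ⟨Z, i, j, hZ, g⟩ := Sem.exists_of_inl hY htn
      obtain ⟨Z', i', j', hZ', g'⟩ := Sem.exists_of_inl hY' htn'
      have hlt := fun s hs => hl s (List.mem_cons_of_mem _ hs)
      have hlt' := fun s hs => hl' s (List.mem_cons_of_mem _ hs)
      obtain ⟨n1, n2⟩ := Sem.not_starts_not_ends hJ htn hlt ha hZ
      obtain ⟨n1', n2'⟩ := Sem.not_starts_not_ends hJ' htn' hlt' ha' hZ'
      -- Steps of different kinds are excluded by `Starts.not_ends`. For two starters all events go
      -- on; for two terminators the events are those of `Y.S`.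
      have key : Set.range i = Set.range i' ∧
          ∀ p p', i p = i' p' → (p ∈ t.1.pom.T ↔ p' ∈ t'.1.pom.T) := by
        rcases t.1.starterPlus_or_terminatorPlus htn with k | k <;>
          rcases t'.1.starterPlus_or_terminatorPlus htn' with k' | k'
        · refine ⟨?_, fun p p' _ => by simp [k.1.2, k'.1.2]⟩
          ext y
          rw [g.mem_range_i_iff k.1.1 (n1 k.1), g'.mem_range_i_iff k'.1.1 (n1' k'.1)]
        · obtain ⟨y, hy⟩ := g.exists_starts k
          obtain ⟨x, hx⟩ := g'.exists_ends k'
          exact (hy.not_ends hx).elim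
        · obtain ⟨y, hy⟩ := g'.exists_starts k'
          obtain ⟨x, hx⟩ := g.exists_ends k
          exact (hy.not_ends hx).elim
        · refine ⟨?_, fun p p' e => not_iff_not.1 ?_⟩
          · rw [g.range_i_of_isTerminator k.1, g'.range_i_of_isTerminator k'.1]
          · rw [g.not_mem_T_iff k.1 (n2 k.1), g'.not_mem_T_iff k'.1 (n2' k'.1), e]
      obtain ⟨f⟩ := g.iso_right g' key.1 key.2
      obtain ⟨r1, r2, r3⟩ := ih hlt hlt' ha.tail ha'.tail hZ (hZ'.of_iso (.refl _) f.symm)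
      exact ⟨rfl, .cons ⟨g.toIsGlue.iso_left g'.toIsGlue key.1 key.2, r1⟩ r2, r3⟩

/-- `sparse_unique` covers everything but the initial identity, which is recovered as the source
interface of the timed ipomset. -/
theorem SparseIdw.same_of_iso {w w' : SparseIdw α} (f : w.tGlue.Iso w'.tGlue) : w.Same w' := by
  obtain ⟨Z, i, j, _, g⟩ := w.exists_isTGlue
  obtain ⟨Z', i', j', _, g'⟩ := w'.exists_isTGlue
  obtain ⟨h1, h2, h3⟩ := sparse_unique w.J.isId w'.J.isId w.not_id w'.not_id w.alternating
    w'.alternating (w.sem_tGlue.of_iso (.refl _) f) w'.sem_tGlue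
  have k := g.of_iso (.refl _) (.refl _) f
  refine ⟨?_, h1, h2, h3⟩
  refine k.toIsGlue.iso_left g'.toIsGlue ?_ fun p p' _ => by simp [w.I.isId.1.2, w'.I.isId.1.2]
  rw [k.range_i_of_isTerminator w.I.isId.2, g'.range_i_of_isTerminator w'.I.isId.2]

/-! ### Every timed ipomset is the meaning of a word -/

/-- The restriction of an ipomset to a set `A` of events, with new interfaces. -/
def Ipomset.restrict (P : Ipomset α) (A S T : Set P.Ev)
    (hS : ∀ x ∈ S, ∀ y ∈ A, ¬ P.lt y x) (hT : ∀ x ∈ T, ∀ y ∈ A, ¬ P.lt x y) : Ipomset α where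
  Ev := A
  finite := by
    have := P.finite
    infer_instance
  lt x y := P.lt x y
  ev x y := P.ev x y
  S := {x | (x : P.Ev) ∈ S}
  T := {x | (x : P.Ev) ∈ T}
  lab x := P.lab x
  lt_irrefl _ := P.lt_irrefl _
  lt_trans _ _ _ := P.lt_trans _ _ _
  ev_irrefl _ := P.ev_irrefl _
  ev_trans _ _ _ := P.ev_trans _ _ _
  ordered x y h := P.ordered x y (fun e => h (Subtype.ext e))
  S_minimal x hx y := hS x hx y y.2
  T_maximal x hx y := hT x hx y y.2
  interval := by
    obtain ⟨lo, hi, h1, h2⟩ := P.interval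
    exact ⟨fun x => lo x, fun x => hi x, fun x => h1 x, fun x y => h2 x y⟩

/-- Splitting off a first step with events `A`, of which those in `B` go on. -/
theorem exists_split (Y : Tipomset α) (A B : Set Y.Ev) (hSA : Y.S ⊆ A) (hBA : B ⊆ A)
    (hmin : ∀ a ∈ A, ∀ y, ¬ Y.lt y a) (hlo : ∀ a ∈ A, Y.lo a = 0)
    (hend : ∀ x ∈ A, x ∉ B → x ∉ Y.T ∧ Y.hi x = 0 ∧ ∀ y, y ∉ A → Y.lt x y) :
    ∃ (P : Ipomset α) (Z : Tipomset α) (i : P.Ev → Y.Ev) (j : Z.Ev → Y.Ev), IsTGlue P Z Y i j ∧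
      P.IsDiscrete ∧ Set.range i = A ∧ ∀ p, p ∈ P.T ↔ i p ∈ B := by
  -- The remainder has all events except those of `A` outside `B`, which end in the first step; `B`
  -- becomes the common interface.
  let C : Set Y.Ev := {y | y ∈ A → y ∈ B}
  let P : Ipomset α := Y.toIpomset.restrict A Y.S B (fun x hx y _ => Y.S_minimal x hx y)
    (fun x _ y hy => hmin y hy x)
  let Z : Tipomset α :=
    { toIpomset := Y.toIpomset.restrict C B Y.T (fun x hx y _ => hmin x (hBA hx) y)
        (fun x hx y _ => Y.T_maximal x hx y)
      lo := fun x => Y.lo x.1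
      hi := fun x => Y.hi x.1
      dur := Y.dur
      lo_le_hi := fun x => Y.lo_le_hi _
      hi_le_dur := fun x => Y.hi_le_dur _
      lo_S := fun x hx => hlo _ (hBA hx)
      hi_T := fun x hx => Y.hi_T _ hx
      lt_of_hi_lt_lo := fun x y => Y.lt_of_hi_lt_lo _ _
      hi_le_lo_of_lt := fun x y => Y.hi_le_lo_of_lt _ _ }
  let i : P.Ev → Y.Ev := Subtype.val
  let j : Z.Ev → Y.Ev := Subtype.val
  have ri : Set.range i = A := Subtype.range_val
  have rj : Set.range j = C := Subtype.range_val
  refine ⟨P, Z, i, j, ⟨⟨Subtype.val_injective, Subtype.val_injective, fun y => ?_, fun p => ?_,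
    fun q => ?_, fun _ => rfl, fun _ => rfl, fun _ _ => Iff.rfl, fun _ _ => Iff.rfl,
    fun p q hp hq => ?_, fun _ _ _ _ => Iff.rfl, fun _ _ _ _ => Iff.rfl, ?_, ?_⟩,
    fun p => hlo _ p.2, fun p hp => (hend _ p.2 hp).2.1, fun _ => rfl, fun _ => rfl, rfl⟩,
    fun (x y : A) => hmin y y.2 x, ri, fun p => Iff.rfl⟩
  · rw [ri, rj]
    by_cases hy : y ∈ A
    · exact Or.inl hy
    · exact Or.inr fun h => (hy h).elim
  · rw [rj]
    exact ⟨fun h _ => h, fun h => h p.2⟩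
  · rw [ri]
    exact ⟨fun h => hBA h, fun h => q.2 h⟩
  · exact (hend _ p.2 hp).2.2 _ (fun h => hq (q.2 h))
  · ext y
    exact ⟨fun h => ⟨⟨y, hSA h⟩, h, rfl⟩, by rintro ⟨p, hp, rfl⟩; exact hp⟩
  · ext y
    refine ⟨fun h => ⟨⟨y, fun hA => ?_⟩, h, rfl⟩, by rintro ⟨p, hp, rfl⟩; exact hp⟩
    by_contra hB
    exact (hend y hA hB).1 h

/-- Since `x` does not start in the sense of `Starts`, it has a predecessor. The predecessor `z`
with the least right endpoint has none itself, and it lives at time `0` only; not being able to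
start, it is a source. -/
theorem Tipomset.exists_lt_of_not_starts {Y : Tipomset α} (h : ∀ y, ¬ Y.Starts y) {x : Y.Ev}
    (hx : x ∉ Y.S) (h0 : Y.lo x = 0) : ∃ z ∈ Y.S, z ∉ Y.T ∧ Y.hi z = 0 ∧ Y.lt z x := by
  have := Y.finite
  obtain ⟨ℓ, r, h1, h2⟩ := Y.interval
  have hne : {z | Y.lt z x}.Nonempty := by
    by_contra hne
    exact h x ⟨hx, h0, fun z hz => hne ⟨z, hz⟩⟩
  obtain ⟨z, hz, hmin⟩ := Set.exists_min_image {z | Y.lt z x} r (Set.toFinite _) hne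
  have hhi : Y.hi z = 0 := le_antisymm ((Y.hi_le_lo_of_lt z x hz).trans_eq h0) zero_le
  refine ⟨z, ?_, fun hT => Y.T_maximal z hT x hz, hhi, hz⟩
  by_contra hS
  refine h z ⟨hS, le_antisymm ((Y.lo_le_hi z).trans_eq hhi) zero_le, fun y hy => ?_⟩
  have h3 := hmin y (Y.lt_trans _ _ _ hy hz)
  exact absurd ((h2 y z).1 hy) (not_lt.2 ((h1 z).trans h3))

/-- The interval order is essential here. Take `x` in `E` with the least right endpoint. A new event
with start `0` is preceded by some `z` in `E`, hence also by `x`, whose right endpoint is no larger;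
a new event with positive start comes after `x` by the times. -/
theorem Tipomset.Active.exists_ends {Y : Tipomset α} (ha : Y.Active) (h : ∀ y, ¬ Y.Starts y) :
    ∃ x, Y.Ends x := by
  have := Y.finite
  obtain ⟨ℓ, r, h1, h2⟩ := Y.interval
  let E : Set Y.Ev := {x | x ∈ Y.S ∧ x ∉ Y.T ∧ Y.hi x = 0}
  have hE : ∀ x, x ∉ Y.S → Y.lo x = 0 → ∃ z ∈ E, Y.lt z x := fun x hx h0 => by
    obtain ⟨z, k1, k2, k3, k4⟩ := Tipomset.exists_lt_of_not_starts h hx h0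
    exact ⟨z, ⟨k1, k2, k3⟩, k4⟩
  have hne : E.Nonempty := by
    obtain ⟨y, ⟨hy, h0⟩ | ⟨hy, h0⟩⟩ := ha
    · obtain ⟨z, hz, _⟩ := hE y hy h0
      exact ⟨z, hz⟩
    · by_cases hS : y ∈ Y.S
      · exact ⟨y, hS, hy, h0⟩
      · obtain ⟨z, hz, _⟩ := hE y hS (le_antisymm ((Y.lo_le_hi y).trans_eq h0) zero_le)
        exact ⟨z, hz⟩
  obtain ⟨x, hx, hmin⟩ := Set.exists_min_image E r (Set.toFinite _) hne
  refine ⟨x, hx.1, hx.2.1, hx.2.2, fun y hy => ?_⟩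
  by_cases h0 : Y.lo y = 0
  · obtain ⟨z, hz, hzy⟩ := hE y hy h0
    exact (h2 x y).2 ((hmin z hz).trans_lt ((h2 z y).1 hzy))
  · exact Y.lt_of_hi_lt_lo _ _ (hx.2.2 ▸ pos_iff_ne_zero.2 h0)

/-- An active timed ipomset is the gluing of a proper step and a timed ipomset. -/
theorem Tipomset.Active.exists_isTGlue {Y : Tipomset α} (ha : Y.Active) :
    ∃ (P : Step α) (Z : Tipomset α) (i : _) (j : _), ¬ P.pom.IsId ∧ IsTGlue P.pom Z Y i j := by
  by_cases h : ∃ y, Y.Starts y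
  · obtain ⟨y, hy⟩ := h
    -- The largest possible starter: the source interface together with everything that starts.
    let A : Set Y.Ev := {y | Y.lo y = 0 ∧ ∀ x, ¬ Y.lt x y}
    obtain ⟨P, Z, i, j, g, hd, hr, hT⟩ := exists_split Y A A
      (fun x hx => ⟨Y.lo_S x hx, Y.S_minimal x hx⟩) subset_rfl (fun a ha => ha.2)
      (fun a ha => ha.1) (fun x h h' => (h' h).elim)
    refine ⟨⟨P, Or.inl ⟨hd, Set.eq_univ_of_forall fun p => (hT p).2 (hr ▸ ⟨p, rfl⟩)⟩⟩, Z, i, j,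
      fun hP => ?_, g⟩
    obtain ⟨p, rfl⟩ : y ∈ Set.range i := hr ▸ hy.2
    exact hy.1 ((g.mem_S_i p).2 (hP.2.2 ▸ Set.mem_univ p))
  · push Not at h
    obtain ⟨x, hx⟩ := ha.exists_ends h
    -- The largest possible terminator: exactly the sources which cannot end yet go on.
    let B : Set Y.Ev := {x | x ∈ Y.S ∧ ¬ Y.Ends x}
    obtain ⟨P, Z, i, j, g, hd, hr, hT⟩ := exists_split Y Y.S B subset_rfl (fun x hx => hx.1)
      Y.S_minimal Y.lo_S (fun x h h' => (not_not.1 fun k => h' ⟨h, k⟩ : Y.Ends x).2)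
    refine ⟨⟨P, Or.inr ⟨hd, Set.eq_univ_of_forall fun p => (g.mem_S_i p).1 (hr ▸ ⟨p, rfl⟩)⟩⟩, Z, i,
      j, fun hP => ?_, g⟩
    obtain ⟨p, rfl⟩ : x ∈ Set.range i := hr ▸ hx.1
    exact ((hT p).1 (hP.1.2 ▸ Set.mem_univ p)).2 hx

/-- Time can be removed as long as nothing happens. -/
theorem Tipomset.exists_shift (X : Tipomset α) (d : ℝ≥0) (hlo : ∀ x, x ∉ X.S → d ≤ X.lo x)
    (hhi : ∀ x, d ≤ X.hi x) (hd : d ≤ X.dur) :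
    ∃ Y : Tipomset α, Nonempty (Shift d Y X) ∧ Y.dur = X.dur - d := by
  refine ⟨⟨X.toIpomset, fun x => X.lo x - d, fun x => X.hi x - d, X.dur - d,
    fun x => tsub_le_tsub_right (X.lo_le_hi x) d, fun x => tsub_le_tsub_right (X.hi_le_dur x) d,
    fun x hx => ?_, fun x hx => ?_, fun x y h => ?_, fun x y h => ?_⟩,
    ⟨⟨.refl _, fun x hx => ?_, fun x => ?_, ?_⟩⟩, rfl⟩
  -- Truncated subtraction keeps the start of a source event at `0`.
  · rw [X.lo_S x hx, zero_tsub]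
  · rw [X.hi_T x hx]
  · exact X.lt_of_hi_lt_lo x y (lt_of_tsub_lt_tsub_right h)
  · exact tsub_le_tsub_right (X.hi_le_lo_of_lt x y h) d
  · exact (tsub_add_cancel_of_le (hlo x hx)).symm
  · exact (tsub_add_cancel_of_le (hhi x)).symm
  · exact (tsub_add_cancel_of_le hd).symm

/-- The delay is the least start outside `S` or end outside `T`. Ends in `T` are no obstacle, as
they equal the duration. -/
theorem Tipomset.exists_shift_active (X : Tipomset α) (h : ¬ ∀ x, x ∈ X.S ∧ x ∈ X.T) :
    ∃ d Y, Nonempty (Shift d Y X) ∧ Y.Active := by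
  have := X.finite
  let t : X.Ev ⊕ X.Ev → ℝ≥0 := Sum.elim X.lo X.hi
  let s : Set (X.Ev ⊕ X.Ev) := {a | Sum.elim (fun x => x ∉ X.S) (fun x => x ∉ X.T) a}
  have hne : s.Nonempty := by
    push Not at h
    obtain ⟨x, hx⟩ := h
    by_cases hS : x ∈ X.S
    · exact ⟨Sum.inr x, hx hS⟩
    · exact ⟨Sum.inl x, hS⟩
  obtain ⟨a, ha, hmin⟩ := Set.exists_min_image s t (Set.toFinite _) hne
  have hd : t a ≤ X.dur := by
    rcases a with x | x
    · exact (X.lo_le_hi x).trans (X.hi_le_dur x)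
    · exact X.hi_le_dur x
  obtain ⟨Y, ⟨f⟩, _⟩ := X.exists_shift (t a) (fun x hx => hmin (Sum.inl x) hx) (fun x => by
    by_cases hx : x ∈ X.T
    · rw [X.hi_T x hx]
      exact hd
    · exact hmin (Sum.inr x) hx) hd
  refine ⟨t a, Y, ⟨f⟩, ?_⟩
  rcases a with x | x
  · obtain ⟨y, e⟩ := f.map.surjective x
    have hy : y ∉ Y.S := fun c => ha (e ▸ (f.map_S y).2 c)
    have h1 : X.lo x = Y.lo y + X.lo x := (congrArg X.lo e).symm.trans (f.map_lo y hy)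
    exact ⟨y, Or.inl ⟨hy, left_eq_add.1 (h1.trans (add_comm _ _))⟩⟩
  · obtain ⟨y, e⟩ := f.map.surjective x
    have hy : y ∉ Y.T := fun c => ha (e ▸ (f.map_T y).2 c)
    have h1 : X.hi x = Y.hi y + X.hi x := (congrArg X.hi e).symm.trans (f.map_hi y)
    exact ⟨y, Or.inr ⟨hy, left_eq_add.1 (h1.trans (add_comm _ _))⟩⟩

/-- The number of events which start or end in an ipomset, counted with multiplicity. -/
noncomputable def Ipomset.size (P : Ipomset α) : ℕ := P.Sᶜ.ncard + P.Tᶜ.ncard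

theorem Ipomset.Iso.size_eq {P Q : Ipomset α} (f : P.Iso Q) : P.size = Q.size := by
  have hS : Q.Sᶜ = f.map '' P.Sᶜ := by
    ext y
    obtain ⟨x, rfl⟩ := f.map.surjective y
    rw [f.map.injective.mem_set_image, Set.mem_compl_iff, Set.mem_compl_iff, f.map_S]
  have hT : Q.Tᶜ = f.map '' P.Tᶜ := by
    ext y
    obtain ⟨x, rfl⟩ := f.map.surjective y
    rw [f.map.injective.mem_set_image, Set.mem_compl_iff, Set.mem_compl_iff, f.map_T]
  rw [size, size, hS, hT, Set.ncard_image_of_injective _ f.map.injective,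
    Set.ncard_image_of_injective _ f.map.injective]

/-- A proper step contains an event which starts in `Y` and is at most a source of `Q`, or one which
ends in `Y` and is absent from `Q`. This makes the peeling terminate. -/
theorem IsGlue.size_lt {P Q Y : Ipomset α} {i : P.Ev → Y.Ev} {j : Q.Ev → Y.Ev}
    (g : IsGlue P Q Y i j) (hd : P.IsDiscrete) (hP : ¬ P.IsId) : Q.size < Y.size := by
  have := Y.finite
  have hS : j '' Q.Sᶜ ⊆ Y.Sᶜ := by
    rintro _ ⟨q, hq, rfl⟩
    exact g.not_mem_S_j hq
  have hT : j '' Q.Tᶜ ⊆ Y.Tᶜ := by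
    rintro _ ⟨q, hq, rfl⟩
    exact fun h => hq ((g.mem_T_j q).1 h)
  rw [Ipomset.size, Ipomset.size, ← Set.ncard_image_of_injective _ g.inj_j,
    ← Set.ncard_image_of_injective Q.Tᶜ g.inj_j]
  by_cases hPS : P.S = Set.univ
  · have hPT : P.T ≠ Set.univ := fun h => hP ⟨⟨hd, h⟩, ⟨hd, hPS⟩⟩
    obtain ⟨p, hp⟩ := (Set.ne_univ_iff_exists_notMem _).1 hPT
    refine add_lt_add_of_le_of_lt (Set.ncard_le_ncard hS) (Set.ncard_lt_ncard ⟨hT, fun h => ?_⟩)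
    obtain ⟨q, _, hq⟩ := h (g.not_mem_T_i hp : i p ∈ Y.Tᶜ)
    exact hp ((g.mem_T p).2 ⟨q, hq⟩)
  · obtain ⟨p, hp⟩ := (Set.ne_univ_iff_exists_notMem _).1 hPS
    refine add_lt_add_of_lt_of_le (Set.ncard_lt_ncard ⟨hS, fun h => ?_⟩) (Set.ncard_le_ncard hT)
    obtain ⟨q, hq, e⟩ := h (fun c => hp ((g.mem_S_i p).1 c) : i p ∈ Y.Sᶜ)
    exact hq ((g.mem_S q).2 ⟨p, e.symm⟩)

theorem IsGlue.composable_of_right {P Q Y O : Ipomset α} {i : P.Ev → Y.Ev} {j : Q.Ev → Y.Ev}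
    (g : IsGlue P Q Y i j) (h : O.Composable Y) : O.Composable P := by
  obtain ⟨k⟩ := h
  obtain ⟨e, he⟩ := exists_equiv_of_range_eq (f := fun y : Y.S => (y : Y.Ev))
    (g := fun s : P.S => i s) Subtype.val_injective (g.inj_i.comp Subtype.val_injective) (by
      ext y
      simp [g.S_eq])
  refine ⟨⟨k.e.trans e, fun x => ?_, fun x y => ?_⟩⟩
  · rw [k.lab_eq, ← he, g.lab_i]
    rfl
  · rw [k.ev_iff, ← he, ← he,
      g.ev_i _ _ (P.S_minimal _ (e _).2 _) (P.S_minimal _ (e _).2 _)]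
    rfl

/-- Remove the idle time, split off a proper step, and recurse on the smaller remainder. When every
event lies in both interfaces, `X` is an identity that lasts for its duration. The second claim
keeps the word coherent with whatever can precede `X`. -/
theorem exists_sem (X : Tipomset α) : ∃ (J : Ident α) (w : DWord α), Sem J.pom w X ∧
    ∀ O : Ipomset α, O.Composable X.toIpomset → Fits O J.pom w := by
  induction hn : X.size using Nat.strong_induction_on generalizing X with
  | _ n ih =>
    by_cases h : ∀ x, x ∈ X.S ∧ x ∈ X.T
    · obtain ⟨Y, ⟨s⟩, hY⟩ := X.exists_shift X.dur (fun x hx => (hx (h x).1).elim)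
        (fun x => (X.hi_T x (h x).2).ge) le_rfl
      have hd : X.IsDiscrete := fun x y => X.S_minimal y (h y).1 x
      have hX : X.IsId := ⟨⟨hd, Set.eq_univ_of_forall fun x => (h x).2⟩,
        ⟨hd, Set.eq_univ_of_forall fun x => (h x).1⟩⟩
      refine ⟨⟨X.toIpomset, hX⟩, [Sum.inr X.dur], ⟨Y, ⟨⟨s.toIso.symm⟩, ?_⟩, ⟨s⟩⟩, fun O hO => ?_⟩
      · rw [hY, tsub_self]
      · exact List.isChain_cons_cons.2 ⟨hO, List.isChain_singleton _⟩
    · obtain ⟨d, Y, ⟨s⟩, ha⟩ := X.exists_shift_active h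
      obtain ⟨P, Z, i, j, hP, g⟩ := ha.exists_isTGlue
      obtain ⟨J, w, hw, hf⟩ := ih Z.size (by
        rw [← hn, ← s.toIso.size_eq]
        exact g.toIsGlue.size_lt P.isDiscrete hP) Z rfl
      refine ⟨J, Sum.inr d :: Sum.inl P :: w, ⟨Y, Or.inr ⟨Z, i, j, hw, g⟩, ⟨s⟩⟩, fun O hO => ?_⟩
      exact fits_inr.2 (fits_inl.2
        ⟨g.toIsGlue.composable_of_right (hO.iso_right s.toIso.symm), hf _ g.toIsGlue.composable⟩)

/-- The identity on the source interface. -/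
theorem Ipomset.exists_ident (P : Ipomset α) : ∃ I : Ident α, I.pom.Composable P := by
  let I : Ipomset α := P.restrict P.S P.S P.S (fun x hx y _ => P.S_minimal x hx y)
    (fun x _ y hy => P.S_minimal y hy x)
  have hd : I.IsDiscrete := fun (x y : P.S) => P.S_minimal y y.2 x
  have hu : ∀ x : P.S, (x : P.Ev) ∈ P.S := fun x => x.2
  exact ⟨⟨I, ⟨hd, Set.eq_univ_of_forall hu⟩, ⟨hd, Set.eq_univ_of_forall hu⟩⟩,
    ⟨⟨Equiv.subtypeUnivEquiv hu, fun _ => rfl, fun _ _ => Iff.rfl⟩⟩⟩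

theorem SparseIdw.exists_tGlue_iso (X : Tipomset α) :
    ∃ w : SparseIdw α, Nonempty (w.tGlue.Iso X) := by
  obtain ⟨J, w, hw, hf⟩ := exists_sem X
  obtain ⟨I, hI⟩ := X.exists_ident
  obtain ⟨d₀, l, hl, ha, hl', hc⟩ := exists_sparse (hf _ hI)
  let v : SparseIdw α := ⟨I, d₀, l, J, fits_innerWord.1 hl', hl, ha⟩
  -- Both `v.tGlue` and `X` are meanings of the sparse word.
  exact ⟨v, v.sem_tGlue.iso ((hc.cong.sem_iff _ _).1 hw)⟩

end TimedConc

theorem mainTheorem6 (α : Type u) :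
    (∀ x : TimedConc.IDW α, ∃ w : TimedConc.SparseIdw α,
      w.toIDW = x ∧ ∀ w' : TimedConc.SparseIdw α, w'.toIDW = x → w'.Same w) ∧
    ∃ tGlue : TimedConc.IDW α → TimedConc.TiPoms α,
      (∀ w : TimedConc.SparseIdw α,
        tGlue w.toIDW = Quotient.mk (TimedConc.Tipomset.setoid α) w.tGlue) ∧
      Function.Bijective tGlue := by
  refine ⟨fun x => ?_, ?_⟩
  · obtain ⟨w, rfl⟩ := TimedConc.exists_toIDW_eq x
    exact ⟨w, rfl, fun w' h => TimedConc.SparseIdw.same_of_iso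
      (TimedConc.SparseIdw.iso_of_toIDW_eq h).some⟩
  -- The map is defined through chosen sparse representatives; `hw` shows that the choice does not
  -- matter.
  · choose s hs using TimedConc.exists_toIDW_eq (α := α)
    have hw : ∀ w : TimedConc.SparseIdw α,
        Quotient.mk (TimedConc.Tipomset.setoid α) (s w.toIDW).tGlue =
          Quotient.mk (TimedConc.Tipomset.setoid α) w.tGlue := fun w =>
      Quotient.sound (TimedConc.SparseIdw.iso_of_toIDW_eq (hs w.toIDW))
    refine ⟨fun x => Quotient.mk _ (s x).tGlue, hw, fun x y hxy => ?_, fun X => ?_⟩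
    · rw [← hs x, ← hs y]
      exact (TimedConc.SparseIdw.same_of_iso (Quotient.exact hxy).some).toIDW_eq
    · obtain ⟨X, rfl⟩ := Quotient.exists_rep X
      obtain ⟨w, hX⟩ := TimedConc.SparseIdw.exists_tGlue_iso X
      exact ⟨w.toIDW, (hw w).trans (Quotient.sound hX)⟩
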